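/- Let $U\in C^4(\mathbb R^d)$ have a global minimum at $0$ with $U(0)=0$, assume $\mathcal Z=\int_{\mathbb R^d} e^{-U(x)}\,dx<\infty$, and let $\mu(dx)=\mathcal Z^{-1}e^{-U(x)}\,dx$. Assume that $L:=\sup_x\|D^2U(x)\|$, $L_H:=\sup_x\|D^3U(x)\|$ and $L_I:=\sup_x\|D^4U(x)\|$ are finite, where $\|\cdot\|$ is the operator norm of multilinear forms with respect to the Euclidean norm $|\cdot|$. Fix $T,h>0$ with $N:=T/h\in\mathbb N$ and $L(T^2+Th)\le 1/6$. For $(x,v)\in\mathbb R^{2d}$ let $(\tilde q_{kh},\tilde v_{kh})_{k\ge 0}$ be the velocity Verlet iterates started at $(\tilde q_0,\tilde v_0)=(x,v)$, $$\tilde q_{(k+1)h}=\tilde q_{kh}+h\,\tilde v_{kh}-\tfrac{h^2}{2}\nabla U(\tilde q_{kh}),\qquad \tilde v_{(k+1)h}=\tilde v_{kh}-\tfrac h2\big(\nabla U(\tilde q_{kh})+\nabla U(\tilde q_{(k+1)h})\big),$$ and let $\tilde\pi(x,A)=P[\tilde q_T(x,\xi)\in A]$, $\xi\sim\mathcal N(0,I_d)$,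 be the one-step transition kernel of unadjusted Hamiltonian Monte Carlo (uHMC) with duration $T$. Let $\tilde\mu$ be an invariant probability measure of $\tilde\pi$ such that $W^1(\mu,\tilde\mu)\le M_2h^2$ for a constant $M_2\in(0,\infty)$, where $W^1(\nu,\eta)=\inf E|X-Y|$ over all couplings $(X,Y)$ of $\nu$ and $\eta$. Then, with $\mathrm{TV}(\nu,\eta)=\sup_A|\nu(A)-\eta(A)|$ (supremum over Borel sets $A$), $$\mathrm{TV}(\mu,\tilde\mu)\ \le\ h^2\Big[\tfrac32\big(T^{-2}+27\,d\,L_H^2T^4\big)^{1/2}M_2+C\Big],$$ where $$\begin{aligned}C:=\Big[&d^3\big(4L_I^2T^4+14L_H^2L_IT^6+14L_H^4T^8\big)+d^2\big(35L_H^2T^2+8L_I^2T^4+28L_H^2L_IT^6+28L_H^4T^8\big)\\&+d\big(16L^2+4L_H^2T^2\big)+\big(2dL_H^2+L^2T^{-2}\big)\int|x|^2\,\mu(dx)\\&+\big(dL_I^2+dL_H^2L_IT^2+dL_H^4T^4+L_H^2T^{-2}\big)\int|x|^4\,\mu(dx)\Big]^{1/2},\end{aligned}$$ the moments of $\mu$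 being taken in $[0,\infty]$. -/

import Mathlib

open MeasureTheory ProbabilityTheory
open scoped ENNReal

noncomputable section

/-- Total variation distance `sup {|μ(A) - ν(A)| : A measurable}`. -/
def tvDist {X : Type*} [MeasurableSpace X] (μ ν : Measure X) : ℝ≥0∞ :=
  ⨆ (A : Set X) (_ : MeasurableSet A), ENNReal.ofReal |μ.real A - ν.real A|

/-- `ω` is a coupling of `μ` and `ν`. -/
def IsCoupling {X : Type*} [MeasurableSpace X] (ω : Measure (X × X)) (μ ν : Measure X) : Prop :=
  ω.map Prod.fst = μ ∧ ω.map Prod.snd = ν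

/-- The `L¹`-Wasserstein distance, with values in `[0, ∞]`. -/
def wasserstein1 {X : Type*} [MeasurableSpace X] [PseudoEMetricSpace X] (μ ν : Measure X) :
    ℝ≥0∞ :=
  ⨅ (ω : Measure (X × X)) (_ : IsCoupling ω μ ν), ∫⁻ p, edist p.1 p.2 ∂ω

/-- The target distribution `μ(dx) = Z⁻¹ exp(-U(x)) dx` on `ℝᵈ`, where `Z = ∫ exp(-U(x)) dx`. -/
def targetMeasure {d : ℕ} (U : EuclideanSpace ℝ (Fin d) → ℝ) :
    Measure (EuclideanSpace ℝ (Fin d)) :=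
  volume.tilted (fun x => -U x)

/-- One velocity Verlet step of size `h`, acting on position-velocity pairs `(q, v)`:
`q' = q + h v - (h²/2) ∇U(q)` and `v' = v - (h/2) (∇U(q) + ∇U(q'))`. -/
def verletStep {d : ℕ} (U : EuclideanSpace ℝ (Fin d) → ℝ) (h : ℝ)
    (z : EuclideanSpace ℝ (Fin d) × EuclideanSpace ℝ (Fin d)) :
    EuclideanSpace ℝ (Fin d) × EuclideanSpace ℝ (Fin d) :=
  let q' := z.1 + h • z.2 - (h ^ 2 / 2) • gradient U z.1
  (q', z.2 - (h / 2) • (gradient U z.1 + gradient U q'))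

/-- The position after `N` velocity Verlet steps of size `h` from position `x` and velocity `v`,
that is, the Verlet position at time `N h`. -/
def verletPos {d : ℕ} (U : EuclideanSpace ℝ (Fin d) → ℝ) (h : ℝ) (N : ℕ)
    (x v : EuclideanSpace ℝ (Fin d)) : EuclideanSpace ℝ (Fin d) :=
  ((verletStep U h)^[N] (x, v)).1

theorem measurable_gradient_aux {d : ℕ} (U : EuclideanSpace ℝ (Fin d) → ℝ) :
    Measurable (gradient U) := by
  have h1 : Measurable (fderiv ℝ U) := measurable_fderiv ℝ U
  exact (InnerProductSpace.toDual ℝ (EuclideanSpace ℝ (Fin d))).symm.continuous.measurable.comp h1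

theorem measurable_verletStep {d : ℕ} (U : EuclideanSpace ℝ (Fin d) → ℝ) (h : ℝ) :
    Measurable (verletStep U h) := by
  have hg := measurable_gradient_aux U
  unfold verletStep
  fun_prop

theorem measurable_verletPos {d : ℕ} (U : EuclideanSpace ℝ (Fin d) → ℝ) (h : ℝ) (N : ℕ) :
    Measurable (fun p : EuclideanSpace ℝ (Fin d) × EuclideanSpace ℝ (Fin d) =>
      verletPos U h N p.1 p.2) :=
  measurable_fst.comp ((measurable_verletStep U h).iterate N)

/-- The one-step transition kernel of unadjusted HMC with `N` Verlet steps of size `h` (duration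
`T = N h`) and complete velocity refreshment: from `x`, it is the law of the Verlet position at
time `T` started from `(x, ξ)` with `ξ ∼ 𝒩(0, I_d)`. -/
def uhmcKernel {d : ℕ} (U : EuclideanSpace ℝ (Fin d) → ℝ) (h : ℝ) (N : ℕ) :
    Kernel (EuclideanSpace ℝ (Fin d)) (EuclideanSpace ℝ (Fin d)) where
  toFun x := (stdGaussian (EuclideanSpace ℝ (Fin d))).map (verletPos U h N x)
  measurable' := by
    have h1 := Measurable.map_prodMk_left (α := EuclideanSpace ℝ (Fin d))
      (ν := stdGaussian (EuclideanSpace ℝ (Fin d)))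
    have h2 := (Measure.measurable_map _ (measurable_verletPos U h N)).comp h1
    refine (congrArg Measurable (funext fun x => ?_)).mp h2
    exact Measure.map_map (measurable_verletPos U h N) measurable_prodMk_left

/-- The constant `C` of the bias bound. It is `∞` when a moment of `μ` that enters with a
nonzero coefficient is infinite. -/
def biasConst (d : ℕ) (L L_H L_I T : ℝ) (μ : Measure (EuclideanSpace ℝ (Fin d))) : ℝ≥0∞ :=
  (ENNReal.ofReal
      ((d : ℝ) ^ 3 * (4 * L_I ^ 2 * T ^ 4 + 14 * L_H ^ 2 * L_I * T ^ 6 + 14 * L_H ^ 4 * T ^ 8)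
        + (d : ℝ) ^ 2 * (35 * L_H ^ 2 * T ^ 2 + 8 * L_I ^ 2 * T ^ 4
            + 28 * L_H ^ 2 * L_I * T ^ 6 + 28 * L_H ^ 4 * T ^ 8)
        + (d : ℝ) * (16 * L ^ 2 + 4 * L_H ^ 2 * T ^ 2))
    + ENNReal.ofReal (2 * (d : ℝ) * L_H ^ 2 + L ^ 2 / T ^ 2) * ∫⁻ x, ‖x‖ₑ ^ 2 ∂μ
    + ENNReal.ofReal ((d : ℝ) * L_I ^ 2 + (d : ℝ) * L_H ^ 2 * L_I * T ^ 2
          + (d : ℝ) * L_H ^ 4 * T ^ 4 + L_H ^ 2 / T ^ 2) * ∫⁻ x, ‖x‖ₑ ^ 4 ∂μ) ^ (1 / 2 : ℝ)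

end

set_option linter.unusedSectionVars false

section Gaussian

variable {E : Type*} [NormedAddCommGroup E] [InnerProductSpace ℝ E] [FiniteDimensional ℝ E]
  [MeasurableSpace E] [BorelSpace E]

/-- The standard Gaussian density without its normalizing constant. -/
noncomputable def gaussianWeight (v : E) : ℝ := Real.exp (-‖v‖ ^ 2 / 2)

theorem gaussianWeight_pos (v : E) : 0 < gaussianWeight v := Real.exp_pos _

theorem hasFDerivAt_gaussianWeight (v : E) :
    HasFDerivAt gaussianWeight (-gaussianWeight v • innerSL ℝ v) v := by
  have h1 : HasFDerivAt (fun v : E => -‖v‖ ^ 2 / 2) (-(innerSL ℝ v)) v := by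
    have h2 := (hasStrictFDerivAt_norm_sq v).hasFDerivAt.const_mul (-1 / 2 : ℝ)
    refine (h2.congr_fderiv ?_).congr_of_eventuallyEq (Filter.Eventually.of_forall fun w => ?_)
    · ext w; simp; ring
    · simp only; ring
  refine h1.exp.congr_fderiv ?_
  simp [gaussianWeight]

theorem continuous_gaussianWeight : Continuous (gaussianWeight : E → ℝ) := by
  unfold gaussianWeight; fun_prop

theorem integral_cexp_gaussian (t : E) :
    ∫ v : E, Complex.exp (-(1 / 2 : ℂ) * ‖v‖ ^ 2 + Complex.I * inner ℝ t v)
      = (2 * Real.pi : ℂ) ^ (Module.finrank ℝ E / 2 : ℂ) * Complex.exp (-‖t‖ ^ 2 / 2) := by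
  rw [GaussianFourier.integral_cexp_neg_mul_sq_norm_add (by norm_num)]
  simp only [Complex.I_sq]
  congr 2
  · field_simp
  · field_simp
    ring

theorem integrable_gaussianWeight : Integrable (gaussianWeight : E → ℝ) := by
  have h := (GaussianFourier.integrable_cexp_neg_mul_sq_norm_add (V := E) (b := (1 / 2 : ℂ))
    (by norm_num) 0 0).re
  refine h.congr (Filter.Eventually.of_forall fun v => ?_)
  have : (-(1 / 2 : ℂ) * ‖v‖ ^ 2 + 0 * inner ℝ (0 : E) v) = ((-‖v‖ ^ 2 / 2 : ℝ) : ℂ) := by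
    push_cast; ring
  beta_reduce
  rw [this, ← Complex.ofReal_exp]
  exact Complex.ofReal_re _

/-- The normalizing constant of the standard Gaussian density. -/
noncomputable def gaussianConst (E : Type*) [NormedAddCommGroup E] [InnerProductSpace ℝ E] : ℝ :=
  ((2 * Real.pi) ^ (Module.finrank ℝ E / 2 : ℝ))⁻¹

theorem gaussianConst_pos : 0 < gaussianConst E := by
  unfold gaussianConst; positivity

theorem integral_withDensity_gaussianWeight {F : Type*} [NormedAddCommGroup F] [NormedSpace ℝ F]
    (f : E → F) :
    ∫ v, f v ∂(volume.withDensity fun v : E => ENNReal.ofReal (gaussianConst E * gaussianWeight v))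
      = gaussianConst E • ∫ v, gaussianWeight v • f v := by
  rw [integral_withDensity_eq_integral_toReal_smul
    (by have := continuous_gaussianWeight (E := E); fun_prop) (by simp)]
  rw [← integral_smul]
  refine integral_congr_ae (Filter.Eventually.of_forall fun v => ?_)
  simp only
  rw [ENNReal.toReal_ofReal (mul_nonneg gaussianConst_pos.le (gaussianWeight_pos v).le), smul_smul]

theorem stdGaussian_eq_withDensity :
    stdGaussian E =
      volume.withDensity fun v => ENNReal.ofReal (gaussianConst E * gaussianWeight v) := by
  have : IsFiniteMeasure
      (volume.withDensity fun v : E => ENNReal.ofReal (gaussianConst E * gaussianWeight v)) :=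
    isFiniteMeasure_withDensity_ofReal (integrable_gaussianWeight.const_mul _).2
  refine Measure.ext_of_charFun (funext fun t => ?_)
  rw [charFun_stdGaussian, charFun_apply, integral_withDensity_gaussianWeight]
  have h := integral_cexp_gaussian t
  have h1 : ∀ v : E, gaussianWeight v • Complex.exp (inner ℝ v t * Complex.I)
      = Complex.exp (-(1 / 2 : ℂ) * ‖v‖ ^ 2 + Complex.I * inner ℝ t v) := by
    intro v
    rw [Complex.exp_add, gaussianWeight, Complex.real_smul, Complex.ofReal_exp, real_inner_comm]
    push_cast
    congr 2 <;> ring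
  simp_rw [h1]
  rw [h, gaussianConst, Complex.real_smul]
  have h2 : (2 * Real.pi : ℂ) ^ (Module.finrank ℝ E / 2 : ℂ)
      = (((2 * Real.pi) ^ (Module.finrank ℝ E / 2 : ℝ) : ℝ) : ℂ) := by
    rw [Complex.ofReal_cpow (by positivity)]
    push_cast; rfl
  have h3 : ((2 * Real.pi) ^ (Module.finrank ℝ E / 2 : ℝ) : ℝ) ≠ 0 := by positivity
  rw [h2, ← mul_assoc, ← Complex.ofReal_mul, inv_mul_cancel₀ h3]
  simp

theorem integral_stdGaussian {F : Type*} [NormedAddCommGroup F] [NormedSpace ℝ F] (f : E → F) :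
    ∫ v, f v ∂(stdGaussian E) = gaussianConst E • ∫ v, gaussianWeight v • f v := by
  rw [stdGaussian_eq_withDensity, integral_withDensity_gaussianWeight]

theorem integrable_stdGaussian_iff {F : Type*} [NormedAddCommGroup F] [NormedSpace ℝ F]
    (f : E → F) :
    Integrable f (stdGaussian E) ↔ Integrable (fun v => gaussianWeight v • f v) := by
  have hc := continuous_gaussianWeight (E := E)
  rw [stdGaussian_eq_withDensity, integrable_withDensity_iff_integrable_smul' (by fun_prop)
    (by simp)]
  rw [← integrable_smul_iff (gaussianConst_pos (E := E)).ne'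
    (f := fun v => gaussianWeight v • f v)]
  refine integrable_congr (Filter.Eventually.of_forall fun v => ?_)
  simp only [Pi.smul_apply]
  rw [ENNReal.toReal_ofReal (mul_nonneg gaussianConst_pos.le (gaussianWeight_pos v).le), smul_smul]

/-- Gaussian integration by parts (Stein's lemma). -/
theorem integral_fderiv_stdGaussian {u : E → ℝ} (e : E) (hu : Differentiable ℝ u)
    (h0 : Integrable u (stdGaussian E))
    (h1 : Integrable (fun v => fderiv ℝ u v e) (stdGaussian E))
    (h2 : Integrable (fun v => inner ℝ v e * u v) (stdGaussian E)) :
    ∫ v, fderiv ℝ u v e ∂(stdGaussian E) = ∫ v, inner ℝ v e * u v ∂(stdGaussian E) := by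
  rw [integrable_stdGaussian_iff] at h0 h1 h2
  simp only [smul_eq_mul] at h0 h1 h2
  rw [integral_stdGaussian, integral_stdGaussian]
  congr 1
  have hw : ∀ v : E, fderiv ℝ gaussianWeight v e = - gaussianWeight v * inner ℝ v e := fun v => by
    rw [(hasFDerivAt_gaussianWeight v).fderiv]; simp
  have key := integral_mul_fderiv_eq_neg_fderiv_mul_of_integrable (𝕜 := ℝ) (μ := (volume : Measure E))
    (f := gaussianWeight) (g := u) (v := e) ?_ h1 h0
    (fun v _ => (hasFDerivAt_gaussianWeight v).differentiableAt) (fun v _ => hu v)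
  · simp only [smul_eq_mul]
    rw [key, ← integral_neg]
    refine integral_congr_ae (Filter.Eventually.of_forall fun v => ?_)
    simp only [hw]; ring
  · refine h2.neg.congr (Filter.Eventually.of_forall fun v => ?_)
    simp only [hw, Pi.neg_apply]; ring

theorem integrable_norm_pow_stdGaussian (n : ℕ) :
    Integrable (fun v : E => ‖v‖ ^ n) (stdGaussian E) := by
  simpa using (IsGaussian.memLp_id (stdGaussian E) n (by simp)).integrable_norm_pow'

theorem integrable_stdGaussian_of_le {F : Type*} [NormedAddCommGroup F] {f : E → F}
    (hf : AEStronglyMeasurable f (stdGaussian E)) (C : ℝ) (n : ℕ)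
    (hC : ∀ v, ‖f v‖ ≤ C * (1 + ‖v‖ ^ n)) : Integrable f (stdGaussian E) :=
  (((integrable_const (1 : ℝ)).add (integrable_norm_pow_stdGaussian n)).const_mul C).mono' hf
    (Filter.Eventually.of_forall hC)

end Gaussian

section GaussianDivergence

variable {E : Type*} [NormedAddCommGroup E] [InnerProductSpace ℝ E] [FiniteDimensional ℝ E]
  [MeasurableSpace E] [BorelSpace E]

theorem sum_inner_stdOrthonormalBasis (v w : E) :
    ∑ i, inner ℝ v (stdOrthonormalBasis ℝ E i) * inner ℝ w (stdOrthonormalBasis ℝ E i)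
      = inner ℝ v w := by
  rw [← (stdOrthonormalBasis ℝ E).sum_inner_mul_inner v w]
  exact Finset.sum_congr rfl fun i _ => by rw [real_inner_comm w]

theorem hasFDerivAt_inner_const (e v : E) :
    HasFDerivAt (fun v : E => inner ℝ v e) (innerSL ℝ e) v := by
  refine (innerSL ℝ e).hasFDerivAt.congr_of_eventuallyEq (Filter.Eventually.of_forall fun w => ?_)
  simp [real_inner_comm]

theorem abs_inner_mul_le (v e : E) (he : ‖e‖ = 1) : |inner ℝ v e| ≤ ‖v‖ := by
  simpa [he] using abs_real_inner_le_norm v e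

theorem integral_norm_sq_stdGaussian :
    ∫ v : E, ‖v‖ ^ 2 ∂(stdGaussian E) = Module.finrank ℝ E := by
  have key : ∀ e : E, ‖e‖ = 1 → ∫ v, inner ℝ v e * inner ℝ v e ∂(stdGaussian E) = 1 ∧
      Integrable (fun v => inner ℝ v e * inner ℝ v e) (stdGaussian E) := by
    intro e he
    have hi : Integrable (fun v => inner ℝ v e * inner ℝ v e) (stdGaussian E) := by
      refine integrable_stdGaussian_of_le (by fun_prop) 1 2 fun v => ?_
      rw [Real.norm_eq_abs, abs_mul]
      nlinarith [abs_inner_mul_le v e he, abs_nonneg (inner ℝ v e), norm_nonneg v]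
    have hf : ∀ v : E, fderiv ℝ (fun v : E => inner ℝ v e) v e = 1 := fun v => by
      rw [(hasFDerivAt_inner_const e v).fderiv]; simp [he]
    have := integral_fderiv_stdGaussian (u := fun v : E => inner ℝ v e) e
      (fun v => (hasFDerivAt_inner_const e v).differentiableAt)
      (integrable_stdGaussian_of_le (by fun_prop) 1 1 fun v => by
        rw [Real.norm_eq_abs]; nlinarith [abs_inner_mul_le v e he])
      (by simp_rw [hf]; exact integrable_const _) hi
    simp_rw [hf] at this
    exact ⟨by rw [← this]; simp, hi⟩
  have h1 : ∀ v : E, ‖v‖ ^ 2 = ∑ i, inner ℝ v (stdOrthonormalBasis ℝ E i)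
      * inner ℝ v (stdOrthonormalBasis ℝ E i) := fun v => by
    rw [sum_inner_stdOrthonormalBasis, real_inner_self_eq_norm_sq]
  simp_rw [h1]
  rw [integral_finsetSum _ fun i _ => (key _ ((stdOrthonormalBasis ℝ E).norm_eq_one i)).2]
  rw [Finset.sum_congr rfl fun i _ => (key _ ((stdOrthonormalBasis ℝ E).norm_eq_one i)).1]
  simp

theorem integral_norm_pow_four_stdGaussian :
    ∫ v : E, ‖v‖ ^ 4 ∂(stdGaussian E)
      = (Module.finrank ℝ E : ℝ) ^ 2 + 2 * Module.finrank ℝ E := by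
  have key : ∀ e : E, ‖e‖ = 1 →
      ∫ v, inner ℝ v e * (‖v‖ ^ 2 * inner ℝ v e) ∂(stdGaussian E)
        = ∫ v, (‖v‖ ^ 2 + 2 * (inner ℝ v e * inner ℝ v e)) ∂(stdGaussian E) ∧
      Integrable (fun v => inner ℝ v e * (‖v‖ ^ 2 * inner ℝ v e)) (stdGaussian E) ∧
      Integrable (fun v => ‖v‖ ^ 2 + 2 * (inner ℝ v e * inner ℝ v e)) (stdGaussian E) := by
    intro e he
    have hb : ∀ v : E, inner ℝ v e * inner ℝ v e ≤ ‖v‖ ^ 2 := fun v => by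
      rw [← abs_mul_abs_self]
      nlinarith [abs_inner_mul_le v e he, abs_nonneg (inner ℝ v e), norm_nonneg v]
    have hi : Integrable (fun v => inner ℝ v e * (‖v‖ ^ 2 * inner ℝ v e)) (stdGaussian E) := by
      refine integrable_stdGaussian_of_le (by fun_prop) 1 4 fun v => ?_
      rw [show inner ℝ v e * (‖v‖ ^ 2 * inner ℝ v e) = ‖v‖ ^ 2 * (inner ℝ v e * inner ℝ v e) by ring,
        Real.norm_eq_abs, abs_mul, abs_of_nonneg (sq_nonneg _), abs_of_nonneg (mul_self_nonneg _)]
      nlinarith [hb v, sq_nonneg ‖v‖]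
    have hi2 : Integrable (fun v => ‖v‖ ^ 2 + 2 * (inner ℝ v e * inner ℝ v e)) (stdGaussian E) := by
      refine integrable_stdGaussian_of_le (by fun_prop) 3 2 fun v => ?_
      rw [Real.norm_eq_abs, abs_of_nonneg (by nlinarith [sq_nonneg ‖v‖, mul_self_nonneg (inner ℝ v e)])]
      nlinarith [hb v, sq_nonneg ‖v‖]
    have hd : ∀ v : E, HasFDerivAt (fun v : E => ‖v‖ ^ 2 * inner ℝ v e)
        (‖v‖ ^ 2 • innerSL ℝ e + inner ℝ v e • (2 • innerSL ℝ v)) v := fun v =>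
      (hasStrictFDerivAt_norm_sq v).hasFDerivAt.mul (hasFDerivAt_inner_const e v)
    have hf : ∀ v : E, fderiv ℝ (fun v : E => ‖v‖ ^ 2 * inner ℝ v e) v e
        = ‖v‖ ^ 2 + 2 * (inner ℝ v e * inner ℝ v e) := fun v => by
      rw [(hd v).fderiv]; simp [he]; ring
    have := integral_fderiv_stdGaussian (u := fun v : E => ‖v‖ ^ 2 * inner ℝ v e) e
      (fun v => (hd v).differentiableAt)
      (integrable_stdGaussian_of_le (by fun_prop) 1 3 fun v => by
        rw [Real.norm_eq_abs, abs_mul, abs_of_nonneg (sq_nonneg _)]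
        nlinarith [abs_inner_mul_le v e he, sq_nonneg ‖v‖])
      (by simp_rw [hf]; exact hi2) hi
    simp_rw [hf] at this
    exact ⟨this.symm, hi, hi2⟩
  have h1 : ∀ v : E, ‖v‖ ^ 4 = ∑ i, inner ℝ v (stdOrthonormalBasis ℝ E i)
      * (‖v‖ ^ 2 * inner ℝ v (stdOrthonormalBasis ℝ E i)) := fun v => by
    have := sum_inner_stdOrthonormalBasis v v
    rw [real_inner_self_eq_norm_sq] at this
    rw [show ‖v‖ ^ 4 = ‖v‖ ^ 2 * ‖v‖ ^ 2 by ring]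
    nth_rewrite 2 [← this]
    rw [Finset.mul_sum]
    exact Finset.sum_congr rfl fun i _ => by ring
  have hn := fun i => (stdOrthonormalBasis ℝ E).norm_eq_one i
  simp_rw [h1]
  rw [integral_finsetSum _ fun i _ => (key _ (hn i)).2.1,
    Finset.sum_congr rfl fun i _ => (key _ (hn i)).1,
    ← integral_finsetSum _ fun i _ => (key _ (hn i)).2.2]
  have h2 : ∀ v : E, ∑ i, (‖v‖ ^ 2 + 2 * (inner ℝ v (stdOrthonormalBasis ℝ E i)
      * inner ℝ v (stdOrthonormalBasis ℝ E i))) = (Module.finrank ℝ E + 2) * ‖v‖ ^ 2 := fun v => by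
    rw [Finset.sum_add_distrib, ← Finset.mul_sum, sum_inner_stdOrthonormalBasis,
      real_inner_self_eq_norm_sq]
    simp; ring
  simp_rw [h2]
  rw [integral_const_mul, integral_norm_sq_stdGaussian]; ring

/-- The (flat) divergence of a vector field. -/
noncomputable def vectorDiv (G : E → E) (v : E) : ℝ :=
  ∑ i, inner ℝ (fderiv ℝ G v (stdOrthonormalBasis ℝ E i)) (stdOrthonormalBasis ℝ E i)

/-- The Gaussian divergence of a vector field, the adjoint of the gradient in `L²` of the standard
Gaussian measure. -/
noncomputable def gaussianDiv (G : E → E) (v : E) : ℝ := inner ℝ v (G v) - vectorDiv G v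

theorem HasCompactSupport.inner_comp {X : Type*} [TopologicalSpace X] {G : X → E}
    (hG : HasCompactSupport G) (f : X → E) :
    HasCompactSupport fun v => inner ℝ (f v) (G v) :=
  hG.mono fun v hv => by
    simp only [Function.mem_support] at hv ⊢
    intro h; exact hv (by rw [h, inner_zero_right])

theorem hasCompactSupport_vectorDiv {G : E → E} (hG : HasCompactSupport G) :
    HasCompactSupport (vectorDiv G) :=
  (hG.fderiv ℝ).mono fun v hv => by
    simp only [Function.mem_support] at hv ⊢
    intro h; exact hv (by simp [vectorDiv, h])

theorem hasCompactSupport_gaussianDiv {G : E → E} (hG : HasCompactSupport G) :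
    HasCompactSupport (gaussianDiv G) :=
  (hG.inner_comp id).sub (hasCompactSupport_vectorDiv hG)

theorem contDiff_vectorDiv {G : E → E} {n : WithTop ℕ∞} (hG : ContDiff ℝ (n + 1) G) :
    ContDiff ℝ n (vectorDiv G) := by
  have h := hG.fderiv_right (m := n) le_rfl
  unfold vectorDiv
  exact ContDiff.sum fun i _ => (h.clm_apply contDiff_const).inner ℝ contDiff_const

theorem contDiff_gaussianDiv {G : E → E} {n : WithTop ℕ∞} (hG : ContDiff ℝ (n + 1) G) :
    ContDiff ℝ n (gaussianDiv G) :=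
  (contDiff_id.inner ℝ (hG.of_le le_self_add)).sub (contDiff_vectorDiv hG)

theorem integral_mul_gaussianDiv {G : E → E} (hG : ContDiff ℝ 1 G) (hs : HasCompactSupport G)
    {u : E → ℝ} (hu : ContDiff ℝ 1 u) :
    ∫ v, u v * gaussianDiv G v ∂(stdGaussian E) = ∫ v, fderiv ℝ u v (G v) ∂(stdGaussian E) := by
  set b := stdOrthonormalBasis ℝ E
  have hud := hu.continuous_fderiv (by norm_num)
  have hGd := hG.continuous_fderiv (by norm_num)
  have hsd := hs.fderiv ℝ
  have huc := hu.continuous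
  have hGc := hG.continuous
  have hc1 : ∀ (e : E), HasCompactSupport fun v => inner ℝ (G v) e := fun e =>
    hs.comp_left (g := fun w => inner ℝ w e) (by simp)
  have hcd : ∀ (e : E), HasCompactSupport fun v => inner ℝ (fderiv ℝ G v e) e := fun e =>
    hsd.comp_left (g := fun A : E →L[ℝ] E => inner ℝ (A e) e) (by simp)
  have hstep : ∀ e : E,
      (∫ v, (fderiv ℝ u v e * inner ℝ (G v) e + u v * inner ℝ (fderiv ℝ G v e) e) ∂(stdGaussian E)
        = ∫ v, u v * (inner ℝ v e * inner ℝ (G v) e) ∂(stdGaussian E)) ∧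
      Integrable (fun v => fderiv ℝ u v e * inner ℝ (G v) e) (stdGaussian E) ∧
      Integrable (fun v => u v * inner ℝ (fderiv ℝ G v e) e) (stdGaussian E) ∧
      Integrable (fun v => u v * (inner ℝ v e * inner ℝ (G v) e)) (stdGaussian E) := by
    intro e
    have i1 : Integrable (fun v => fderiv ℝ u v e * inner ℝ (G v) e) (stdGaussian E) :=
      Continuous.integrable_of_hasCompactSupport (by fun_prop) ((hc1 e).mul_left)
    have i2 : Integrable (fun v => u v * inner ℝ (fderiv ℝ G v e) e) (stdGaussian E) :=
      Continuous.integrable_of_hasCompactSupport (by fun_prop) ((hcd e).mul_left)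
    have i3 : Integrable (fun v => u v * (inner ℝ v e * inner ℝ (G v) e)) (stdGaussian E) :=
      Continuous.integrable_of_hasCompactSupport (by fun_prop) ((hc1 e).mul_left.mul_left)
    refine ⟨?_, i1, i2, i3⟩
    have hd : ∀ v, HasFDerivAt (fun v => u v * inner ℝ (G v) e)
        (u v • ((innerSL ℝ e).comp (fderiv ℝ G v)) + inner ℝ (G v) e • fderiv ℝ u v) v := fun v =>
      ((hu.differentiable (by norm_num)) v).hasFDerivAt.mul
        ((hasFDerivAt_inner_const e (G v)).comp v ((hG.differentiable (by norm_num)) v).hasFDerivAt)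
    have hf : ∀ v, fderiv ℝ (fun v => u v * inner ℝ (G v) e) v e
        = fderiv ℝ u v e * inner ℝ (G v) e + u v * inner ℝ (fderiv ℝ G v e) e := fun v => by
      rw [(hd v).fderiv]; simp [real_inner_comm]; ring
    have := integral_fderiv_stdGaussian (u := fun v => u v * inner ℝ (G v) e) e
      (fun v => (hd v).differentiableAt)
      (Continuous.integrable_of_hasCompactSupport (by fun_prop) ((hc1 e).mul_left))
      (by simp_rw [hf]; exact i1.add i2)
      (i3.congr (Filter.Eventually.of_forall fun v => by ring))
    simp_rw [hf] at this
    rw [this]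
    exact integral_congr_ae (Filter.Eventually.of_forall fun v => by ring)
  have hL : ∀ v, u v * gaussianDiv G v = ∑ i, (u v * (inner ℝ v (b i) * inner ℝ (G v) (b i))
      - u v * inner ℝ (fderiv ℝ G v (b i)) (b i)) := fun v => by
    rw [Finset.sum_sub_distrib, ← Finset.mul_sum, ← Finset.mul_sum, sum_inner_stdOrthonormalBasis,
      gaussianDiv, vectorDiv, mul_sub]
  have hR : ∀ v, fderiv ℝ u v (G v) = ∑ i, fderiv ℝ u v (b i) * inner ℝ (G v) (b i) := fun v => by
    conv_lhs => rw [← b.sum_repr' (G v)]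
    simp [real_inner_comm, mul_comm]
  simp_rw [hL, hR]
  rw [integral_finsetSum _ fun i _ => ((hstep (b i)).2.2.2.sub (hstep (b i)).2.2.1 :
      Integrable (fun v => _ - _) _),
    integral_finsetSum _ fun i _ => (hstep (b i)).2.1]
  refine Finset.sum_congr rfl fun i _ => ?_
  obtain ⟨h1, h2, h3, h4⟩ := hstep (b i)
  rw [integral_sub h4 h3, ← h1, integral_add h2 h3]; ring

theorem fderiv_vectorDiv {G : E → E} (hG : ContDiff ℝ 2 G) (v w : E) :
    fderiv ℝ (vectorDiv G) v w = ∑ i, inner ℝ (fderiv ℝ (fderiv ℝ G) v w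
      (stdOrthonormalBasis ℝ E i)) (stdOrthonormalBasis ℝ E i) := by
  have h := (hG.fderiv_right (m := 1) (by norm_num)).differentiable (by norm_num)
  have hd : ∀ e : E, HasFDerivAt (fun v => inner ℝ (fderiv ℝ G v e) e)
      ((innerSL ℝ e).comp ((fderiv ℝ (fderiv ℝ G) v).flip e)) v := fun e => by
    have h1 := (hasFDerivAt_inner_const e (fderiv ℝ G v e)).comp v
      ((h v).hasFDerivAt.clm_apply (hasFDerivAt_const e v))
    refine h1.congr_fderiv ?_
    ext w; simp
  have hs := HasFDerivAt.fun_sum (u := Finset.univ)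
    fun i _ => hd (stdOrthonormalBasis ℝ E i)
  rw [show fderiv ℝ (vectorDiv G) v = _ from hs.fderiv]
  simp [real_inner_comm]

/-- The Gaussian Bochner identity `E(δG)² = E|G|² + E tr(DG DG)`. -/
theorem integral_gaussianDiv_sq {G : E → E} (hG : ContDiff ℝ 2 G) (hs : HasCompactSupport G) :
    ∫ v, gaussianDiv G v ^ 2 ∂(stdGaussian E)
      = ∫ v, (‖G v‖ ^ 2 + ∑ i, inner ℝ (fderiv ℝ G v (fderiv ℝ G v (stdOrthonormalBasis ℝ E i)))
          (stdOrthonormalBasis ℝ E i)) ∂(stdGaussian E) := by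
  set b := stdOrthonormalBasis ℝ E
  have hGf := hG.fderiv_right (m := 1) (by norm_num)
  have hG1 : ContDiff ℝ 1 G := hG.of_le (by norm_num)
  have hGc := hG.continuous
  have hGd := hGf.continuous
  have hsd := hs.fderiv ℝ
  set H : E → E := fun v => fderiv ℝ G v (G v) with hH
  have hHc : ContDiff ℝ 1 H := hGf.clm_apply hG1
  have hHs : HasCompactSupport H := hs.mono fun v hv => by
    simp only [Function.mem_support, hH] at hv ⊢
    intro h; exact hv (by rw [h, map_zero])
  have hdH : ∀ v w, fderiv ℝ H v w
      = fderiv ℝ (fderiv ℝ G) v w (G v) + fderiv ℝ G v (fderiv ℝ G v w) := fun v w => by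
    have := ((hGf.differentiable (by norm_num)) v).hasFDerivAt.clm_apply
      ((hG1.differentiable (by norm_num)) v).hasFDerivAt
    rw [hH, this.fderiv]; simp [add_comm]
  have hpt : ∀ v, fderiv ℝ (gaussianDiv G) v (G v) = (‖G v‖ ^ 2
      + ∑ i, inner ℝ (fderiv ℝ G v (fderiv ℝ G v (b i))) (b i)) + gaussianDiv H v := fun v => by
    have h1 : HasFDerivAt (gaussianDiv G) _ v :=
      ((hasFDerivAt_id v).inner ℝ ((hG1.differentiable (by norm_num)) v).hasFDerivAt).sub
        (((contDiff_vectorDiv (n := 1) hG).differentiable (by norm_num)) v).hasFDerivAt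
    have hsymm : ∀ w, fderiv ℝ (fderiv ℝ G) v (G v) w = fderiv ℝ (fderiv ℝ G) v w (G v) :=
      fun w => (hG.contDiffAt.isSymmSndFDerivAt (by simp)).eq _ _
    rw [h1.fderiv]
    simp only [sub_apply, fderiv_vectorDiv hG, gaussianDiv, vectorDiv, hdH,
      inner_add_left, Finset.sum_add_distrib, hsymm]
    simp [hH]
    ring
  have h1 := integral_mul_gaussianDiv hG1 hs (contDiff_gaussianDiv (n := 1) hG)
  have h2 := integral_mul_gaussianDiv hHc hHs (contDiff_const (c := (1 : ℝ)))
  simp only [one_mul, fderiv_fun_const, Pi.zero_apply, zero_apply,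
    integral_zero] at h2
  simp_rw [sq (gaussianDiv G _), h1, hpt]
  rw [integral_add, h2, add_zero]
  · refine Continuous.integrable_of_hasCompactSupport (by fun_prop) (HasCompactSupport.intro hs fun v hv => ?_)
    simp [image_eq_zero_of_notMem_tsupport hv, fderiv_of_notMem_tsupport ℝ hv]
  · exact (contDiff_gaussianDiv (n := 0) (by simpa using hHc)).continuous.integrable_of_hasCompactSupport
      (hasCompactSupport_gaussianDiv hHs)

theorem integral_gaussianDiv_sq_le {G : E → E} (hG : ContDiff ℝ 2 G) (hs : HasCompactSupport G) :
    ∫ v, gaussianDiv G v ^ 2 ∂(stdGaussian E)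
      ≤ ∫ v, (‖G v‖ ^ 2 + Module.finrank ℝ E * ‖fderiv ℝ G v‖ ^ 2) ∂(stdGaussian E) := by
  have hGc := hG.continuous
  have hGd := (hG.fderiv_right (m := 1) (by norm_num)).continuous
  rw [integral_gaussianDiv_sq hG hs]
  refine integral_mono ?_ ?_ fun v => ?_
  · refine Continuous.integrable_of_hasCompactSupport (by fun_prop)
      (HasCompactSupport.intro hs fun v hv => ?_)
    simp [image_eq_zero_of_notMem_tsupport hv, fderiv_of_notMem_tsupport ℝ hv]
  · refine Continuous.integrable_of_hasCompactSupport (by fun_prop)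
      (HasCompactSupport.intro hs fun v hv => ?_)
    simp [image_eq_zero_of_notMem_tsupport hv, fderiv_of_notMem_tsupport ℝ hv]
  · simp only
    gcongr
    calc _ ≤ ∑ _i : Fin (Module.finrank ℝ E), ‖fderiv ℝ G v‖ ^ 2 := by
          refine Finset.sum_le_sum fun i _ => ?_
          have hb := (stdOrthonormalBasis ℝ E).norm_eq_one i
          calc _ ≤ ‖fderiv ℝ G v (fderiv ℝ G v (stdOrthonormalBasis ℝ E i))‖ * 1 := by
                rw [← hb]; exact real_inner_le_norm _ _
            _ ≤ ‖fderiv ℝ G v‖ * (‖fderiv ℝ G v‖ * ‖stdOrthonormalBasis ℝ E i‖) := by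
                rw [mul_one]
                exact (ContinuousLinearMap.le_opNorm _ _).trans
                  (by gcongr; exact ContinuousLinearMap.le_opNorm _ _)
            _ = _ := by rw [hb]; ring
      _ = _ := by simp

end GaussianDivergence

section GaussianTransport

variable {E : Type*} [NormedAddCommGroup E] [InnerProductSpace ℝ E] [FiniteDimensional ℝ E]
  [MeasurableSpace E] [BorelSpace E]

theorem integral_abs_le_sqrt_integral_sq {Ω : Type*} [MeasurableSpace Ω] {P : Measure Ω}
    [IsProbabilityMeasure P] {X : Ω → ℝ} (h1 : Integrable X P)
    (h2 : Integrable (fun ω => X ω ^ 2) P) :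
    ∫ ω, |X ω| ∂P ≤ Real.sqrt (∫ ω, X ω ^ 2 ∂P) := by
  set m := ∫ ω, |X ω| ∂P with hm
  have hexp : ∫ ω, (|X ω| - m) ^ 2 ∂P = (∫ ω, X ω ^ 2 ∂P) - m ^ 2 := by
    have : ∀ ω, (|X ω| - m) ^ 2 = X ω ^ 2 - 2 * m * |X ω| + m ^ 2 := fun ω => by
      rw [sub_sq, sq_abs]; ring
    simp_rw [this]
    rw [integral_add (by exact h2.sub (h1.abs.const_mul _)) (integrable_const _),
      integral_sub h2 (h1.abs.const_mul _), integral_const_mul, ← hm]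
    simp; ring
  have h0 : 0 ≤ ∫ ω, (|X ω| - m) ^ 2 ∂P := integral_nonneg fun ω => sq_nonneg _
  exact Real.le_sqrt_of_sq_le (by linarith)

theorem exists_smooth_cutoff (E : Type*) [NormedAddCommGroup E] [InnerProductSpace ℝ E]
    [FiniteDimensional ℝ E] : ∃ C : ℝ, 0 ≤ C ∧ ∀ R : ℝ, 0 < R → ∃ χ : E → ℝ,
      ContDiff ℝ 2 χ ∧ HasCompactSupport χ ∧ (∀ v, 0 ≤ χ v) ∧ (∀ v, χ v ≤ 1) ∧
      (∀ v, ‖v‖ ≤ R → χ v = 1) ∧ ∀ v, ‖fderiv ℝ χ v‖ ≤ C / R := by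
  let f : ContDiffBump (0 : E) := ⟨1, 2, by norm_num, by norm_num⟩
  have hf : ContDiff ℝ 2 f := f.contDiff
  obtain ⟨C, hC⟩ := (f.hasCompactSupport.fderiv ℝ).exists_bound_of_continuous
    (hf.continuous_fderiv (by norm_num))
  refine ⟨C, (norm_nonneg _).trans (hC 0), fun R hR => ⟨fun v => f (R⁻¹ • v), ?_, ?_, ?_, ?_, ?_, ?_⟩⟩
  · exact hf.comp (contDiff_const_smul _)
  · exact f.hasCompactSupport.comp_homeomorph (Homeomorph.smulOfNeZero R⁻¹ (inv_ne_zero hR.ne'))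
  · exact fun v => f.nonneg
  · exact fun v => f.le_one
  · intro v hv
    refine f.one_of_mem_closedBall ?_
    rw [mem_closedBall_zero_iff, norm_smul, norm_inv, Real.norm_of_nonneg hR.le]
    exact inv_mul_le_one_of_le₀ hv hR.le
  · intro v
    have h : HasFDerivAt (fun v => f (R⁻¹ • v))
        ((fderiv ℝ f (R⁻¹ • v)).comp (R⁻¹ • ContinuousLinearMap.id ℝ E)) v :=
      ((hf.differentiable (by norm_num)) _).hasFDerivAt.comp v
        ((hasFDerivAt_id v).const_smul R⁻¹)
    rw [h.fderiv, ContinuousLinearMap.comp_smul, norm_smul, ContinuousLinearMap.comp_id, norm_inv,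
      Real.norm_of_nonneg hR.le, div_eq_inv_mul]
    gcongr
    exact hC _

theorem abs_integral_fderiv_apply_le {u : E → ℝ} (hu : ContDiff ℝ 1 u) (hu1 : ∀ v, |u v| ≤ 1)
    {G : E → E} (hG : ContDiff ℝ 2 G) (h1 : Integrable (fun v => ‖G v‖ ^ 2) (stdGaussian E))
    (h2 : Integrable (fun v => ‖fderiv ℝ G v‖ ^ 2) (stdGaussian E))
    (h3 : Integrable (fun v => fderiv ℝ u v (G v)) (stdGaussian E)) :
    |∫ v, fderiv ℝ u v (G v) ∂(stdGaussian E)|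
      ≤ Real.sqrt (∫ v, (‖G v‖ ^ 2 + Module.finrank ℝ E * ‖fderiv ℝ G v‖ ^ 2) ∂(stdGaussian E)) := by
  set D : ℝ := ((Module.finrank ℝ E : ℕ) : ℝ)
  have hD : 0 ≤ D := Nat.cast_nonneg _
  obtain ⟨C, hC0, hC⟩ := exists_smooth_cutoff E
  choose χ hχs hχc hχ0 hχ1 hχeq hχd using fun n : ℕ => hC (n + 1) (by positivity)
  have hGd := (hG.fderiv_right (m := 1) (by norm_num)).continuous
  have hud := hu.continuous_fderiv (by norm_num)
  have huc := hu.continuous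
  have hGc := hG.continuous
  set A := ∫ v, ‖G v‖ ^ 2 ∂(stdGaussian E)
  set B := ∫ v, ‖fderiv ℝ G v‖ ^ 2 ∂(stdGaussian E)
  set ε : ℕ → ℝ := fun n => C / (n + 1)
  have hε0 : ∀ n, 0 ≤ ε n := fun n => by positivity
  have hbound : ∀ n, |∫ v, χ n v * fderiv ℝ u v (G v) ∂(stdGaussian E)|
      ≤ Real.sqrt (A + D * ((1 + ε n) * B + (ε n + ε n ^ 2) * A)) := by
    intro n
    set H : E → E := fun v => χ n v • G v with hH
    have hHc : ContDiff ℝ 2 H := (hχs n).smul hG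
    have hHs : HasCompactSupport H := (hχc n).smul_right
    have hHd : ∀ v, ‖fderiv ℝ H v‖ ≤ ‖fderiv ℝ G v‖ + ε n * ‖G v‖ := fun v => by
      have hd := (((hχs n).differentiable (by norm_num)) v).hasFDerivAt.fun_smul
        ((hG.differentiable (by norm_num)) v).hasFDerivAt
      rw [hH, hd.fderiv]
      refine (norm_add_le _ _).trans (add_le_add ?_ ?_)
      · rw [norm_smul, Real.norm_of_nonneg (hχ0 n v)]
        exact mul_le_of_le_one_left (norm_nonneg _) (hχ1 n v)
      · rw [ContinuousLinearMap.norm_smulRight_apply]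
        gcongr
        exact hχd n v
    have hHle : ∀ v, ‖H v‖ ≤ ‖G v‖ := fun v => by
      rw [hH, norm_smul, Real.norm_of_nonneg (hχ0 n v)]
      exact mul_le_of_le_one_left (norm_nonneg _) (hχ1 n v)
    have hdc : Continuous (gaussianDiv H) :=
      (contDiff_gaussianDiv (E := E) (G := H) (n := 1) (by simpa [one_add_one_eq_two] using hHc)).continuous
    have hds := hasCompactSupport_gaussianDiv hHs
    have hdi : Integrable (gaussianDiv H) (stdGaussian E) := hdc.integrable_of_hasCompactSupport hds
    have hdi2 : Integrable (fun v => gaussianDiv H v ^ 2) (stdGaussian E) := by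
      simp_rw [sq]
      exact (hdc.mul hdc).integrable_of_hasCompactSupport hds.mul_left
    have e1 : ∫ v, χ n v * fderiv ℝ u v (G v) ∂(stdGaussian E)
        = ∫ v, u v * gaussianDiv H v ∂(stdGaussian E) := by
      rw [integral_mul_gaussianDiv (hHc.of_le (by norm_num)) hHs hu]
      simp [hH]
    rw [e1]
    calc |∫ v, u v * gaussianDiv H v ∂(stdGaussian E)|
        ≤ ∫ v, |u v * gaussianDiv H v| ∂(stdGaussian E) := abs_integral_le_integral_abs
      _ ≤ ∫ v, |gaussianDiv H v| ∂(stdGaussian E) := by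
          refine integral_mono_of_nonneg (Filter.Eventually.of_forall fun v => abs_nonneg _) hdi.abs
            (Filter.Eventually.of_forall fun v => ?_)
          simp only [abs_mul]
          exact mul_le_of_le_one_left (abs_nonneg _) (hu1 v)
      _ ≤ Real.sqrt (∫ v, gaussianDiv H v ^ 2 ∂(stdGaussian E)) :=
          integral_abs_le_sqrt_integral_sq hdi hdi2
      _ ≤ _ := Real.sqrt_le_sqrt ((integral_gaussianDiv_sq_le hHc hHs).trans ?_)
    have hi4 : Integrable (fun v => (1 + ε n) * ‖fderiv ℝ G v‖ ^ 2 + (ε n + ε n ^ 2) * ‖G v‖ ^ 2)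
        (stdGaussian E) := (h2.const_mul _).add (h1.const_mul _)
    have e2 : A + D * ((1 + ε n) * B + (ε n + ε n ^ 2) * A)
        = ∫ v, (‖G v‖ ^ 2 + D * ((1 + ε n) * ‖fderiv ℝ G v‖ ^ 2 + (ε n + ε n ^ 2) * ‖G v‖ ^ 2))
          ∂(stdGaussian E) := by
      rw [integral_add h1 (hi4.const_mul D),
        integral_const_mul, integral_add (h2.const_mul _) (h1.const_mul _), integral_const_mul,
        integral_const_mul]
    rw [e2]
    refine integral_mono_of_nonneg (Filter.Eventually.of_forall fun v => by positivity)
      (h1.add (hi4.const_mul D))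
      (Filter.Eventually.of_forall fun v => ?_)
    simp only
    have h4 := hHle v
    have h5 := hHd v
    gcongr ?_ + D * ?_
    · gcongr
    · calc _ ≤ (‖fderiv ℝ G v‖ + ε n * ‖G v‖) ^ 2 := by gcongr
        _ ≤ _ := by nlinarith [mul_nonneg (hε0 n) (sq_nonneg (‖fderiv ℝ G v‖ - ‖G v‖))]
  have hεlim : Filter.Tendsto ε Filter.atTop (nhds 0) := by
    have := (tendsto_one_div_add_atTop_nhds_zero_nat (𝕜 := ℝ)).const_mul C
    simpa [ε, div_eq_mul_inv] using this
  have hR : Filter.Tendsto (fun n => Real.sqrt (A + D * ((1 + ε n) * B + (ε n + ε n ^ 2) * A)))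
      Filter.atTop (nhds (Real.sqrt (A + D * ((1 + 0) * B + (0 + 0 ^ 2) * A)))) := by
    refine (Real.continuous_sqrt.tendsto _).comp ?_
    exact tendsto_const_nhds.add (tendsto_const_nhds.mul
      (((tendsto_const_nhds.add hεlim).mul_const _).add ((hεlim.add (hεlim.pow 2)).mul_const _)))
  have hL : Filter.Tendsto (fun n => |∫ v, χ n v * fderiv ℝ u v (G v) ∂(stdGaussian E)|)
      Filter.atTop (nhds |∫ v, fderiv ℝ u v (G v) ∂(stdGaussian E)|) := by
    refine (tendsto_integral_of_dominated_convergence (fun v => ‖fderiv ℝ u v (G v)‖) ?_ h3.norm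
      ?_ ?_).abs
    · intro n
      have := (hχs n).continuous
      exact Continuous.aestronglyMeasurable (by fun_prop)
    · intro n
      refine Filter.Eventually.of_forall fun v => ?_
      rw [norm_mul, Real.norm_of_nonneg (hχ0 n v)]
      exact mul_le_of_le_one_left (norm_nonneg _) (hχ1 n v)
    · refine Filter.Eventually.of_forall fun v => tendsto_const_nhds.congr' ?_
      filter_upwards [Filter.eventually_ge_atTop ⌈‖v‖⌉₊] with n hn
      rw [hχeq n v, one_mul]
      have : (⌈‖v‖⌉₊ : ℝ) ≤ n := by exact_mod_cast hn
      linarith [Nat.le_ceil ‖v‖]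
  have := le_of_tendsto_of_tendsto' hL hR hbound
  rw [integral_add h1 (h2.const_mul _), integral_const_mul]
  simpa using this

/-- Two probability measures whose integrals against all compactly supported `C^1` functions
with values in `[0, 1]` are within `c` are within `c` in total variation. -/
theorem abs_measureReal_sub_le_of_smooth {m₀ m₁ : Measure E} [IsProbabilityMeasure m₀]
    [IsProbabilityMeasure m₁] {c : ℝ}
    (h : ∀ f : E → ℝ, ContDiff ℝ 1 f → HasCompactSupport f → (∀ v, |f v| ≤ 1) →
      |∫ v, f v ∂m₁ - ∫ v, f v ∂m₀| ≤ c) {A : Set E} (hA : MeasurableSet A) :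
    |m₁.real A - m₀.real A| ≤ c := by
  refine le_of_forall_pos_le_add fun ε hε => ?_
  set m := m₀ + m₁ with hm
  obtain ⟨K, hKA, hK, hKm⟩ := hA.exists_isCompact_lt_add (μ := m) (measure_ne_top _ _)
    (ε := ENNReal.ofReal (ε / 2)) (by simpa using hε)
  obtain ⟨V, hKV, hV, hVm⟩ := K.exists_isOpen_lt_add (μ := m) (measure_ne_top _ _)
    (ε := ENNReal.ofReal (ε / 2)) (by simpa using hε)
  obtain ⟨R, hR⟩ := hK.isBounded.subset_ball (0 : E)
  have hW : IsOpen (V ∩ Metric.ball 0 R) := hV.inter Metric.isOpen_ball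
  have hKW : K ⊆ V ∩ Metric.ball 0 R := Set.subset_inter hKV hR
  obtain ⟨f, hf, hf01, hf0, hf1⟩ := exists_contMDiff_zero_iff_one_iff_of_isClosed
    (modelWithCornersSelf ℝ E) (n := 1) hW.isClosed_compl hK.isClosed
    (Set.disjoint_left.2 fun x hx hxK => hx (hKW hxK))
  have hfc : ContDiff ℝ 1 f := hf.contDiff
  have hb : ∀ v, 0 ≤ f v ∧ f v ≤ 1 := fun v => hf01 ⟨v, rfl⟩
  have hfs : HasCompactSupport f := by
    refine HasCompactSupport.intro (isCompact_closedBall (0 : E) R) fun v hv => (hf0 v).1 ?_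
    exact fun hv' => hv (Metric.ball_subset_closedBall hv'.2)
  have key := h f hfc hfs fun v => abs_le.2 ⟨by linarith [hb v], (hb v).2⟩
  have hsplit : ∀ B, m.real B = m₀.real B + m₁.real B := fun B => by
    rw [hm, measureReal_add_apply]
  have hKm' : m.real A ≤ m.real K + ε / 2 := by
    have := ENNReal.toReal_mono (by finiteness) hKm.le
    rwa [ENNReal.toReal_add (by finiteness) (by finiteness), ENNReal.toReal_ofReal (by positivity)]
      at this
  have hVm' : m.real V ≤ m.real K + ε / 2 := by
    have := ENNReal.toReal_mono (by finiteness) hVm.le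
    rwa [ENNReal.toReal_add (by finiteness) (by finiteness), ENNReal.toReal_ofReal (by positivity)]
      at this
  have hint : ∀ n : Measure E, IsProbabilityMeasure n →
      n.real K ≤ ∫ v, f v ∂n ∧ ∫ v, f v ∂n ≤ n.real V := by
    intro n _
    have hfi : Integrable f n := hfc.continuous.integrable_of_hasCompactSupport hfs
    rw [← integral_indicator_one hK.measurableSet, ← integral_indicator_one hV.measurableSet]
    constructor
    · refine integral_mono ((integrable_const 1).indicator hK.measurableSet) hfi fun v => ?_
      by_cases hv : v ∈ K
      · simp [hv, (hf1 v).1 hv]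
      · simp [hv, (hb v).1]
    · refine integral_mono hfi ((integrable_const 1).indicator hV.measurableSet) fun v => ?_
      by_cases hv : v ∈ V
      · simp [hv, (hb v).2]
      · simp [hv, (hf0 v).1 fun hv' => hv hv'.1]
  have i0 := hint m₀ inferInstance
  have i1 := hint m₁ inferInstance
  have k0 : m₀.real K ≤ m₀.real A := measureReal_mono hKA
  have k1 : m₁.real K ≤ m₁.real A := measureReal_mono hKA
  have l0 : m₀.real K ≤ m₀.real V := measureReal_mono hKV
  have l1 : m₁.real K ≤ m₁.real V := measureReal_mono hKV
  rw [hsplit, hsplit] at hKm' hVm'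
  rw [abs_le] at key ⊢
  constructor <;> linarith [key.1, key.2]

end GaussianTransport

section GaussianInterpolation

variable {E : Type*} [NormedAddCommGroup E] [InnerProductSpace ℝ E] [FiniteDimensional ℝ E]

theorem norm_le_of_near_smul_id {A : E →L[ℝ] E} {T : ℝ} (hT : 0 < T)
    (hA : ‖A - T • ContinuousLinearMap.id ℝ E‖ ≤ T / 11) (w : E) :
    T * ‖w‖ ≤ 11 / 10 * ‖A w‖ := by
  have h1 : ‖(A - T • ContinuousLinearMap.id ℝ E) w‖ ≤ T / 11 * ‖w‖ :=
    (ContinuousLinearMap.le_opNorm _ _).trans (by gcongr)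
  have h2 : T • w = A w - (A - T • ContinuousLinearMap.id ℝ E) w := by simp
  have h3 : T * ‖w‖ ≤ ‖A w‖ + T / 11 * ‖w‖ := by
    rw [← Real.norm_of_nonneg hT.le, ← norm_smul, h2, Real.norm_of_nonneg hT.le]
    exact (norm_sub_le _ _).trans (by gcongr)
  linarith

theorem norm_segment_le {X : Type*} [NormedAddCommGroup X] [NormedSpace ℝ X] {s : ℝ}
    (hs : s ∈ Set.Icc (0 : ℝ) 1) {x y : X} {c : ℝ} (hx : ‖x‖ ≤ c) (hy : ‖y‖ ≤ c) :
    ‖(1 - s) • x + s • y‖ ≤ c := by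
  refine (norm_add_le _ _).trans ?_
  rw [norm_smul, norm_smul, Real.norm_of_nonneg hs.1, Real.norm_of_nonneg (by linarith [hs.2])]
  nlinarith [hs.1, hs.2]

theorem isUnit_of_near_smul_id {A : E →L[ℝ] E} {T : ℝ} (hT : 0 < T)
    (hA : ‖A - T • ContinuousLinearMap.id ℝ E‖ ≤ T / 11) : IsUnit A := by
  have h1 : ‖(1 : E →L[ℝ] E) - T⁻¹ • A‖ < 1 := by
    have : (1 : E →L[ℝ] E) - T⁻¹ • A = (-T⁻¹) • (A - T • ContinuousLinearMap.id ℝ E) := by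
      rw [smul_sub, smul_smul, neg_mul, inv_mul_cancel₀ hT.ne']
      simp only [neg_smul, one_smul, sub_neg_eq_add]
      rw [ContinuousLinearMap.one_def]; abel
    rw [this, norm_smul, norm_neg, norm_inv, Real.norm_of_nonneg hT.le]
    calc T⁻¹ * _ ≤ T⁻¹ * (T / 11) := by gcongr
      _ < 1 := by field_simp; norm_num
  have h2 := isUnit_one_sub_of_norm_lt_one h1
  rw [sub_sub_cancel] at h2
  have h3 : A = (Units.mk0 T hT.ne') • (T⁻¹ • A) := by
    rw [Units.smul_def, Units.val_mk0, smul_smul, mul_inv_cancel₀ hT.ne', one_smul]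
  rw [h3]
  exact h2.smul _

/-- If `DF` is uniformly close to `T • id`, the equation `DF(v) G(v) = f(v)` has a `C^2` solution,
with bounds on the solution and on its derivative. -/
theorem exists_preimage_vectorField {F f : E → E} (hF : ContDiff ℝ 3 F) (hf : ContDiff ℝ 2 f)
    {T K : ℝ} (hT : 0 < T)
    (hF1 : ∀ v, ‖fderiv ℝ F v - T • ContinuousLinearMap.id ℝ E‖ ≤ T / 11)
    (hF2 : ∀ v, ‖fderiv ℝ (fderiv ℝ F) v‖ ≤ K) {α β : E → ℝ}
    (hα : ∀ v, 11 / 10 * ‖f v‖ ≤ T * α v)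
    (hβ : ∀ v, 11 / 10 * (‖fderiv ℝ f v‖ + K * α v) ≤ T * β v) :
    ∃ G : E → E, ContDiff ℝ 2 G ∧ (∀ v, fderiv ℝ F v (G v) = f v) ∧ (∀ v, ‖G v‖ ≤ α v) ∧
      ∀ v, ‖fderiv ℝ G v‖ ≤ β v := by
  have hF' : ContDiff ℝ 2 (fderiv ℝ F) := hF.fderiv_right (by norm_num)
  set G : E → E := fun v => Ring.inverse (fderiv ℝ F v) (f v) with hG
  have hGc : ContDiff ℝ 2 G := by
    refine ContDiff.clm_apply (contDiff_iff_contDiffAt.2 fun v => ?_) hf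
    obtain ⟨u, hu⟩ := isUnit_of_near_smul_id hT (hF1 v)
    exact ContDiffAt.comp v (hu ▸ contDiffAt_ringInverse ℝ u) hF'.contDiffAt
  have hFG : ∀ v, fderiv ℝ F v (G v) = f v := fun v => by
    rw [hG, ← mul_apply_eq_comp,
      Ring.mul_inverse_cancel _ (isUnit_of_near_smul_id hT (hF1 v)), one_apply_eq_self]
  have hGα : ∀ v, ‖G v‖ ≤ α v := fun v => by
    have h := norm_le_of_near_smul_id hT (hF1 v) (G v)
    rw [hFG] at h
    exact le_of_mul_le_mul_left (h.trans (hα v)) hT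
  refine ⟨G, hGc, hFG, hGα, fun v => ?_⟩
  have hK : 0 ≤ K := (norm_nonneg (fderiv ℝ (fderiv ℝ F) v)).trans (hF2 v)
  have hβ0 : 0 ≤ β v := by
    have h1 : 0 ≤ α v := (norm_nonneg _).trans (hGα v)
    have h2 : 0 ≤ T * β v := le_trans (by positivity) (hβ v)
    exact nonneg_of_mul_nonneg_right h2 hT
  refine ContinuousLinearMap.opNorm_le_bound _ hβ0 fun w => ?_
  have hd := ((hF'.differentiable (by norm_num)) v).hasFDerivAt.clm_apply
    ((hGc.differentiable (by norm_num)) v).hasFDerivAt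
  simp_rw [hFG] at hd
  have he := congrArg (fun A : E →L[ℝ] E => A w) hd.fderiv
  simp only [add_apply, ContinuousLinearMap.comp_apply, ContinuousLinearMap.flip_apply] at he
  have h := norm_le_of_near_smul_id hT (hF1 v) (fderiv ℝ G v w)
  rw [← sub_eq_iff_eq_add.2 he] at h
  have h4 : ‖fderiv ℝ f v w - fderiv ℝ (fderiv ℝ F) v w (G v)‖
      ≤ (‖fderiv ℝ f v‖ + K * α v) * ‖w‖ := by
    rw [add_mul]
    refine (norm_sub_le _ _).trans (add_le_add (ContinuousLinearMap.le_opNorm _ _) ?_)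
    calc _ ≤ ‖fderiv ℝ (fderiv ℝ F) v‖ * ‖w‖ * ‖G v‖ := ContinuousLinearMap.le_opNorm₂ _ _ _
      _ ≤ K * ‖w‖ * α v := by gcongr; exacts [hF2 v, hGα v]
      _ = _ := by ring
  refine le_of_mul_le_mul_left ?_ hT
  calc _ ≤ 11 / 10 * ((‖fderiv ℝ f v‖ + K * α v) * ‖w‖) := h.trans (by gcongr)
    _ = (11 / 10 * (‖fderiv ℝ f v‖ + K * α v)) * ‖w‖ := by ring
    _ ≤ T * β v * ‖w‖ := mul_le_mul_of_nonneg_right (hβ v) (norm_nonneg _)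
    _ = _ := by ring

variable [MeasurableSpace E] [BorelSpace E]

/-- Total variation bound between the images of the standard Gaussian measure under two maps whose
derivatives are uniformly close to `T • id`. -/
theorem abs_measureReal_map_stdGaussian_sub_le {F₀ F₁ : E → E} (hF₀ : ContDiff ℝ 3 F₀)
    (hF₁ : ContDiff ℝ 3 F₁) {T K : ℝ} (hT : 0 < T)
    (h₀ : ∀ v, ‖fderiv ℝ F₀ v - T • ContinuousLinearMap.id ℝ E‖ ≤ T / 11)
    (h₁ : ∀ v, ‖fderiv ℝ F₁ v - T • ContinuousLinearMap.id ℝ E‖ ≤ T / 11)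
    (hK₀ : ∀ v, ‖fderiv ℝ (fderiv ℝ F₀) v‖ ≤ K) (hK₁ : ∀ v, ‖fderiv ℝ (fderiv ℝ F₁) v‖ ≤ K)
    {α β : E → ℝ} (hα : ∀ v, 11 / 10 * ‖F₁ v - F₀ v‖ ≤ T * α v)
    (hβ : ∀ v, 11 / 10 * (‖fderiv ℝ F₁ v - fderiv ℝ F₀ v‖ + K * α v) ≤ T * β v)
    (hαi : Integrable (fun v => α v ^ 2) (stdGaussian E))
    (hβi : Integrable (fun v => β v ^ 2) (stdGaussian E)) {A : Set E} (hA : MeasurableSet A) :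
    |((stdGaussian E).map F₁).real A - ((stdGaussian E).map F₀).real A|
      ≤ Real.sqrt (∫ v, (α v ^ 2 + Module.finrank ℝ E * β v ^ 2) ∂(stdGaussian E)) := by
  have hc₀ := hF₀.continuous
  have hc₁ := hF₁.continuous
  have hd₀ := hF₀.differentiable (by norm_num)
  have hd₁ := hF₁.differentiable (by norm_num)
  have hdd₀ := (hF₀.fderiv_right (m := 2) (by norm_num)).differentiable (by norm_num)
  have hdd₁ := (hF₁.fderiv_right (m := 2) (by norm_num)).differentiable (by norm_num)
  have := Measure.isProbabilityMeasure_map (μ := stdGaussian E) hc₀.measurable.aemeasurable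
  have := Measure.isProbabilityMeasure_map (μ := stdGaussian E) hc₁.measurable.aemeasurable
  have hα0 : ∀ v, 0 ≤ α v := fun v =>
    nonneg_of_mul_nonneg_right (le_trans (by positivity) (hα v)) hT
  refine abs_measureReal_sub_le_of_smooth (fun f hf hfs hf1 => ?_) hA
  rw [integral_map hc₁.measurable.aemeasurable hf.continuous.aestronglyMeasurable,
    integral_map hc₀.measurable.aemeasurable hf.continuous.aestronglyMeasurable]
  have hfd := hf.continuous_fderiv (by norm_num)
  obtain ⟨C, hC⟩ := (hfs.fderiv ℝ).exists_bound_of_continuous hfd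
  have hC0 : 0 ≤ C := (norm_nonneg _).trans (hC 0)
  set F : ℝ → E → E := fun s v => F₀ v + s • (F₁ v - F₀ v) with hF
  set Φ : ℝ → ℝ := fun s => ∫ v, f (F s v) ∂(stdGaussian E) with hΦ
  have hFs : ∀ s, ContDiff ℝ 3 (F s) := fun s => hF₀.add ((hF₁.sub hF₀).const_smul s)
  have hFd : ∀ s v, fderiv ℝ (F s) v = (1 - s) • fderiv ℝ F₀ v + s • fderiv ℝ F₁ v :=
    fun s v => by
      have : HasFDerivAt (F s) _ v :=
        (hd₀ v).hasFDerivAt.add (((hd₁ v).hasFDerivAt.sub (hd₀ v).hasFDerivAt).const_smul s)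
      rw [this.fderiv]; module
  have hFdd : ∀ s v, fderiv ℝ (fderiv ℝ (F s)) v
      = (1 - s) • fderiv ℝ (fderiv ℝ F₀) v + s • fderiv ℝ (fderiv ℝ F₁) v :=
    fun s v => by
      rw [funext (hFd s)]
      exact (((hdd₀ v).hasFDerivAt.const_smul (1 - s)).add
        ((hdd₁ v).hasFDerivAt.const_smul s)).fderiv
  have hdom : Integrable (fun v => C * ‖F₁ v - F₀ v‖) (stdGaussian E) := by
    refine Integrable.const_mul (Integrable.mono' (((integrable_const 1).add hαi).const_mul T)
      (Continuous.aestronglyMeasurable (by fun_prop)) (Filter.Eventually.of_forall fun v => ?_)) C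
    have h1 : α v ≤ 1 + α v ^ 2 := by nlinarith [sq_nonneg (α v - 1)]
    have h2 : T * α v ≤ T * (1 + α v ^ 2) := by gcongr
    rw [norm_norm]
    simp only [Pi.add_apply]
    linarith [hα v, norm_nonneg (F₁ v - F₀ v)]
  have hΦd : ∀ s, HasDerivAt Φ (∫ v, fderiv ℝ f (F s v) (F₁ v - F₀ v) ∂(stdGaussian E)) s := by
    intro s
    have hFc : ∀ s, Continuous (F s) := fun s => (hFs s).continuous
    refine (hasDerivAt_integral_of_dominated_loc_of_deriv_le (s := Set.univ)
      (F' := fun s v => fderiv ℝ f (F s v) (F₁ v - F₀ v)) (bound := fun v => C * ‖F₁ v - F₀ v‖)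
      Filter.univ_mem (Filter.Eventually.of_forall fun s =>
        (hf.continuous.comp (hFc s)).aestronglyMeasurable) ?_ ?_ ?_ hdom ?_).2
    · exact Integrable.of_bound (hf.continuous.comp (hFc s)).aestronglyMeasurable 1
        (Filter.Eventually.of_forall fun v => hf1 _)
    · have := hFc s
      exact Continuous.aestronglyMeasurable (by fun_prop)
    · refine Filter.Eventually.of_forall fun v s _ => ?_
      exact (ContinuousLinearMap.le_opNorm _ _).trans (by gcongr; exact hC _)
    · refine Filter.Eventually.of_forall fun v s _ => ?_
      have h1 : HasDerivAt (fun s => F s v) (F₁ v - F₀ v) s := by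
        simpa [hF] using ((hasDerivAt_id s).smul_const (F₁ v - F₀ v)).const_add (F₀ v)
      exact ((hf.differentiable (by norm_num)) _).hasFDerivAt.comp_hasDerivAt s h1
  have hmain : ∀ s ∈ Set.Icc (0 : ℝ) 1, ‖∫ v, fderiv ℝ f (F s v) (F₁ v - F₀ v) ∂(stdGaussian E)‖
      ≤ Real.sqrt (∫ v, (α v ^ 2 + Module.finrank ℝ E * β v ^ 2) ∂(stdGaussian E)) := by
    intro s hs
    have hFs1 : ∀ v, ‖fderiv ℝ (F s) v - T • ContinuousLinearMap.id ℝ E‖ ≤ T / 11 := fun v => by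
      rw [hFd, show (1 - s) • fderiv ℝ F₀ v + s • fderiv ℝ F₁ v - T • ContinuousLinearMap.id ℝ E
        = (1 - s) • (fderiv ℝ F₀ v - T • ContinuousLinearMap.id ℝ E)
          + s • (fderiv ℝ F₁ v - T • ContinuousLinearMap.id ℝ E) by module]
      exact norm_segment_le hs (h₀ v) (h₁ v)
    have hFs2 : ∀ v, ‖fderiv ℝ (fderiv ℝ (F s)) v‖ ≤ K := fun v => by
      rw [hFdd]
      exact norm_segment_le (X := E →L[ℝ] E →L[ℝ] E) hs (hK₀ v) (hK₁ v)
    have hdiff : ∀ v, fderiv ℝ (fun v => F₁ v - F₀ v) v = fderiv ℝ F₁ v - fderiv ℝ F₀ v :=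
      fun v => fderiv_fun_sub (hd₁ v) (hd₀ v)
    obtain ⟨G, hGc, hG, hGα, hGβ⟩ := exists_preimage_vectorField (hFs s)
      ((hF₁.sub hF₀).of_le (by norm_num)) hT hFs1 hFs2 hα (fun v => by rw [hdiff]; exact hβ v)
    have hGd := (hGc.fderiv_right (m := 1) (by norm_num)).continuous
    have hGcc := hGc.continuous
    have hFc := (hFs s).continuous
    have hu : ContDiff ℝ 1 (f ∘ F s) := hf.comp ((hFs s).of_le (by norm_num))
    have hud : ∀ v, fderiv ℝ (f ∘ F s) v (G v) = fderiv ℝ f (F s v) (F₁ v - F₀ v) := fun v => by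
      rw [fderiv_comp v ((hf.differentiable (by norm_num)) _)
        (((hFs s).differentiable (by norm_num)) v), ContinuousLinearMap.comp_apply, hG]
    have hi1 : Integrable (fun v => ‖G v‖ ^ 2) (stdGaussian E) :=
      hαi.mono' (by fun_prop) (Filter.Eventually.of_forall fun v => by
        rw [Real.norm_of_nonneg (by positivity)]; gcongr; exact hGα v)
    have hi2 : Integrable (fun v => ‖fderiv ℝ G v‖ ^ 2) (stdGaussian E) :=
      hβi.mono' (by fun_prop) (Filter.Eventually.of_forall fun v => by
        rw [Real.norm_of_nonneg (by positivity)]; gcongr; exact hGβ v)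
    have key := abs_integral_fderiv_apply_le hu (fun v => hf1 _) hGc hi1 hi2 (by
      simp_rw [hud]
      refine hdom.mono' (Continuous.aestronglyMeasurable (by fun_prop))
        (Filter.Eventually.of_forall fun v => ?_)
      exact (ContinuousLinearMap.le_opNorm _ _).trans (by gcongr; exact hC _))
    simp_rw [hud] at key
    refine key.trans (Real.sqrt_le_sqrt (integral_mono (hi1.add (hi2.const_mul _))
      (hαi.add (hβi.const_mul _)) fun v => ?_))
    have := hGα v
    have := hGβ v
    simp only
    gcongr
  have hfin := norm_image_sub_le_of_norm_deriv_le_segment_01'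
    (fun s _ => (hΦd s).hasDerivWithinAt) fun s hs => hmain s ⟨hs.1, hs.2.le⟩
  simpa [hΦ, hF] using hfin

end GaussianInterpolation

section SecondDifferences

variable {W : Type*} [NormedAddCommGroup W] [NormedSpace ℝ W]

/-- `N` steps of size `h` make up the duration `T`, which is short compared with `L`. -/
structure StepCondition (T h L : ℝ) (N : ℕ) : Prop where
  T_pos : 0 < T
  h_pos : 0 < h
  L_nonneg : 0 ≤ L
  mul_eq : N * h = T
  le : L * T ^ 2 ≤ 1 / 6

theorem norm_sub_le_of_secondDiff {a r : ℕ → W} {b : W} {h ρ : ℝ} {N : ℕ}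
    (h1 : a 1 = a 0 + h • b + (1 / 2 : ℝ) • r 0)
    (h2 : ∀ n, a (n + 2) = (2 : ℝ) • a (n + 1) - a n + r (n + 1))
    (hr : ∀ n < N, ‖r n‖ ≤ ρ) :
    (∀ n < N, ‖a (n + 1) - a n - h • b‖ ≤ (n + 1 / 2) * ρ) ∧
      ∀ n ≤ N, ‖a n - a 0 - (n * h) • b‖ ≤ n ^ 2 / 2 * ρ := by
  have hd : ∀ n < N, ‖a (n + 1) - a n - h • b‖ ≤ (n + 1 / 2) * ρ := by
    intro n
    induction n with
    | zero =>
      intro hn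
      rw [zero_add, h1, show a 0 + h • b + (1 / 2 : ℝ) • r 0 - a 0 - h • b = (1 / 2 : ℝ) • r 0 by abel,
        norm_smul, Real.norm_of_nonneg (by norm_num)]
      have := hr 0 hn
      push_cast
      linarith
    | succ n ih =>
      intro hn
      have e : a (n + 1 + 1) - a (n + 1) - h • b = (a (n + 1) - a n - h • b) + r (n + 1) := by
        rw [show n + 1 + 1 = n + 2 from rfl, h2 n]; module
      rw [e]
      refine (norm_add_le _ _).trans ?_
      have h3 := ih (by omega)
      have h4 := hr (n + 1) hn
      push_cast
      linarith
  refine ⟨hd, fun n => ?_⟩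
  induction n with
  | zero => intro _; simp
  | succ n ih =>
    intro hn
    have e : a (n + 1) - a 0 - (((n + 1 : ℕ) : ℝ) * h) • b
        = (a n - a 0 - (n * h) • b) + (a (n + 1) - a n - h • b) := by
      push_cast; module
    rw [e]
    refine (norm_add_le _ _).trans ?_
    have h3 := ih (by omega)
    have h4 := hd n (by omega)
    push_cast
    linarith

/-- Discrete Gronwall inequality for second order recursions over a short duration. -/
theorem secondDiff_bounds {T h L : ℝ} {N : ℕ} (hc : StepCondition T h L N) {a r : ℕ → W} {b : W}
    {A B s M : ℝ} (hs : 0 ≤ s) (h1 : a 1 = a 0 + h • b + (1 / 2 : ℝ) • r 0)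
    (h2 : ∀ n, a (n + 2) = (2 : ℝ) • a (n + 1) - a n + r (n + 1))
    (hr : ∀ n < N, ‖r n‖ ≤ h ^ 2 * (L * ‖a n‖ + s)) (hA : ‖a 0‖ ≤ A) (hB : ‖b‖ ≤ B)
    (hM : 12 / 11 * (A + T * B + T ^ 2 / 2 * s) ≤ M) :
    (∀ n ≤ N, ‖a n‖ ≤ M) ∧ (∀ n < N, ‖r n‖ ≤ h ^ 2 * (L * M + s)) ∧
      (∀ n < N, ‖a (n + 1) - a n‖ ≤ h * (B + T * (L * M + s))) ∧
      ‖a N - a 0 - T • b‖ ≤ T ^ 2 / 2 * (L * M + s) := by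
  have hh := hc.h_pos
  have hT := hc.T_pos
  have hL := hc.L_nonneg
  obtain ⟨m, hm, hmax⟩ := Finset.exists_max_image (Finset.range (N + 1)) (fun n => ‖a n‖) (by simp)
  simp only [Finset.mem_range, Nat.lt_succ_iff] at hm hmax
  have hB0 : 0 ≤ B := (norm_nonneg _).trans hB
  have hnT : ∀ n ≤ N, (n : ℝ) * h ≤ T := fun n hn => by
    rw [← hc.mul_eq]; gcongr
  have hm1 : ∀ n < N, ‖r n‖ ≤ h ^ 2 * (L * ‖a m‖ + s) := fun n hn =>
    (hr n hn).trans (by gcongr; exact hmax n hn.le)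
  have hsq : ∀ n ≤ N, ∀ c, 0 ≤ c → (n : ℝ) ^ 2 / 2 * (h ^ 2 * c) ≤ T ^ 2 / 2 * c := fun n hn c hc0 => by
    rw [show (n : ℝ) ^ 2 / 2 * (h ^ 2 * c) = (n * h) ^ 2 / 2 * c by ring]
    have := hnT n hn
    gcongr
  have hmM : ‖a m‖ ≤ M := by
    have h3 := (norm_sub_le_of_secondDiff h1 h2 hm1).2 m hm
    have h4 : ‖a m‖ ≤ ‖a m - a 0 - (m * h) • b‖ + ‖a 0‖ + ‖((m : ℝ) * h) • b‖ := by
      refine le_trans (le_of_eq ?_) (norm_add₃_le (a := a m - a 0 - (m * h) • b))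
      congr 1; abel
    have h5 : ‖((m : ℝ) * h) • b‖ ≤ T * B := by
      rw [norm_smul, Real.norm_of_nonneg (by positivity)]
      have := hnT m hm
      gcongr
    have h6 := hsq m hm (L * ‖a m‖ + s) (by positivity)
    have h7 : L * T ^ 2 * ‖a m‖ ≤ 1 / 6 * ‖a m‖ := by
      have := hc.le
      gcongr
    nlinarith
  have hM0 : 0 ≤ M := (norm_nonneg _).trans hmM
  have hr' : ∀ n < N, ‖r n‖ ≤ h ^ 2 * (L * M + s) := fun n hn =>
    (hm1 n hn).trans (by gcongr)
  obtain ⟨k1, k2⟩ := norm_sub_le_of_secondDiff h1 h2 hr'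
  refine ⟨fun n hn => (hmax n hn).trans hmM, hr', fun n hn => ?_, ?_⟩
  · have h3 := k1 n hn
    have h4 : ‖a (n + 1) - a n‖ ≤ ‖a (n + 1) - a n - h • b‖ + ‖h • b‖ := by
      simpa using norm_add_le (a (n + 1) - a n - h • b) (h • b)
    rw [norm_smul, Real.norm_of_nonneg hh.le] at h4
    have h5 : ((n : ℝ) + 1 / 2) * h ≤ T := by
      have := hnT (n + 1) hn
      push_cast at this
      nlinarith
    have h6 : ((n : ℝ) + 1 / 2) * h * (h * (L * M + s)) ≤ T * (h * (L * M + s)) := by gcongr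
    have h7 : h * ‖b‖ ≤ h * B := by gcongr
    nlinarith
  · have h3 := k2 N le_rfl
    rw [hc.mul_eq] at h3
    exact h3.trans (hsq N le_rfl _ (by positivity))

end SecondDifferences

section SmoothForce

variable {E X : Type*} [NormedAddCommGroup E] [NormedSpace ℝ E] [NormedAddCommGroup X]
  [NormedSpace ℝ X]

theorem norm_sub_le_of_fderiv_le {f : E → X} (hf : Differentiable ℝ f) {C : ℝ}
    (hC : ∀ x, ‖fderiv ℝ f x‖ ≤ C) (x y : E) : ‖f x - f y‖ ≤ C * ‖x - y‖ :=
  convex_univ.norm_image_sub_le_of_norm_fderiv_le (fun z _ => hf z) (fun z _ => hC z)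
    (Set.mem_univ y) (Set.mem_univ x)

theorem norm_sub_sub_fderiv_le {f : E → X} (hf : ContDiff ℝ 2 f) {C : ℝ}
    (hC : ∀ x, ‖fderiv ℝ (fderiv ℝ f) x‖ ≤ C) (x y : E) :
    ‖f y - f x - fderiv ℝ f x (y - x)‖ ≤ C * ‖y - x‖ ^ 2 := by
  have hC0 : 0 ≤ C := (norm_nonneg (fderiv ℝ (fderiv ℝ f) x)).trans (hC x)
  have h1 := norm_sub_le_of_fderiv_le
    ((hf.fderiv_right (m := 1) (by norm_num)).differentiable (by norm_num)) hC
  have h2 := (convex_segment x y).norm_image_sub_le_of_norm_hasFDerivWithin_le'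
    (f := f) (f' := fderiv ℝ f) (φ := fderiv ℝ f x) (C := C * ‖y - x‖)
    (fun z _ => ((hf.differentiable (by norm_num)) z).hasFDerivAt.hasFDerivWithinAt)
    (fun z hz => (h1 z x).trans (by
      have := norm_sub_le_of_mem_segment hz
      gcongr)) (left_mem_segment ℝ x y) (right_mem_segment ℝ x y)
  rw [sq, ← mul_assoc]
  exact h2

theorem norm_secondDiff_comp_le {f : E → X} (hf : ContDiff ℝ 2 f) {C₁ C₂ : ℝ}
    (hC₁ : ∀ x, ‖fderiv ℝ f x‖ ≤ C₁) (hC₂ : ∀ x, ‖fderiv ℝ (fderiv ℝ f) x‖ ≤ C₂) (a b c : E) :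
    ‖f c - (2 : ℝ) • f b + f a‖
      ≤ C₁ * ‖c - (2 : ℝ) • b + a‖ + C₂ * (‖c - b‖ ^ 2 + ‖a - b‖ ^ 2) := by
  have h1 := norm_sub_sub_fderiv_le hf hC₂ b c
  have h2 := norm_sub_sub_fderiv_le hf hC₂ b a
  have h3 : ‖fderiv ℝ f b (c - (2 : ℝ) • b + a)‖ ≤ C₁ * ‖c - (2 : ℝ) • b + a‖ :=
    (ContinuousLinearMap.le_opNorm _ _).trans (by gcongr; exact hC₁ b)
  have e : f c - (2 : ℝ) • f b + f a = fderiv ℝ f b (c - (2 : ℝ) • b + a)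
      + ((f c - f b - fderiv ℝ f b (c - b)) + (f a - f b - fderiv ℝ f b (a - b))) := by
    simp only [map_add, map_sub, map_smul]; module
  rw [e]
  refine (norm_add_le _ _).trans (add_le_add h3 ((norm_add_le _ _).trans ?_))
  linarith

/-- A `C^3` vector field vanishing at `0` with bounds on its first three derivatives. -/
structure SmoothForce (g : E → E) (L L_H L_I : ℝ) : Prop where
  contDiff : ContDiff ℝ 3 g
  map_zero : g 0 = 0
  norm_fderiv_le : ∀ x, ‖fderiv ℝ g x‖ ≤ L
  norm_fderiv_two_le : ∀ x, ‖fderiv ℝ (fderiv ℝ g) x‖ ≤ L_H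
  norm_fderiv_three_le : ∀ x, ‖fderiv ℝ (fderiv ℝ (fderiv ℝ g)) x‖ ≤ L_I

namespace SmoothForce

variable {g : E → E} {L L_H L_I : ℝ}

theorem differentiable (hg : SmoothForce g L L_H L_I) : Differentiable ℝ g :=
  hg.contDiff.differentiable (by norm_num)

theorem contDiff_fderiv (hg : SmoothForce g L L_H L_I) : ContDiff ℝ 2 (fderiv ℝ g) :=
  hg.contDiff.fderiv_right (by norm_num)

theorem L_nonneg (hg : SmoothForce g L L_H L_I) : 0 ≤ L :=
  (norm_nonneg _).trans (hg.norm_fderiv_le 0)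

theorem L_H_nonneg (hg : SmoothForce g L L_H L_I) : 0 ≤ L_H :=
  (norm_nonneg (fderiv ℝ (fderiv ℝ g) 0)).trans (hg.norm_fderiv_two_le 0)

theorem L_I_nonneg (hg : SmoothForce g L L_H L_I) : 0 ≤ L_I :=
  (norm_nonneg (fderiv ℝ (fderiv ℝ (fderiv ℝ g)) 0)).trans (hg.norm_fderiv_three_le 0)

theorem norm_sub_le (hg : SmoothForce g L L_H L_I) (x y : E) : ‖g x - g y‖ ≤ L * ‖x - y‖ :=
  norm_sub_le_of_fderiv_le hg.differentiable hg.norm_fderiv_le x y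

theorem norm_le (hg : SmoothForce g L L_H L_I) (x : E) : ‖g x‖ ≤ L * ‖x‖ := by
  simpa [hg.map_zero] using hg.norm_sub_le x 0

theorem norm_fderiv_sub_le (hg : SmoothForce g L L_H L_I) (x y : E) :
    ‖fderiv ℝ g x - fderiv ℝ g y‖ ≤ L_H * ‖x - y‖ :=
  norm_sub_le_of_fderiv_le (hg.contDiff_fderiv.differentiable (by norm_num))
    hg.norm_fderiv_two_le x y

theorem norm_fderiv_comp_sub_le (hg : SmoothForce g L L_H L_I) (x y : E) (P Q : E →L[ℝ] E) :
    ‖(fderiv ℝ g x).comp P - (fderiv ℝ g y).comp Q‖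
      ≤ L * ‖P - Q‖ + L_H * ‖x - y‖ * ‖Q‖ := by
  have e : (fderiv ℝ g x).comp P - (fderiv ℝ g y).comp Q
      = (fderiv ℝ g x).comp (P - Q) + (fderiv ℝ g x - fderiv ℝ g y).comp Q := by
    rw [ContinuousLinearMap.comp_sub, ContinuousLinearMap.sub_comp]; abel
  rw [e]
  refine (norm_add_le _ _).trans (add_le_add ?_ ?_)
  · exact (ContinuousLinearMap.opNorm_comp_le _ _).trans (by gcongr; exact hg.norm_fderiv_le x)
  · exact (ContinuousLinearMap.opNorm_comp_le _ _).trans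
      (by gcongr; exact hg.norm_fderiv_sub_le x y)

end SmoothForce

end SmoothForce

section VerletSequence

variable {E : Type*} [NormedAddCommGroup E] [NormedSpace ℝ E]

/-- The positions of the velocity Verlet scheme with force `-g`, in Störmer form. -/
noncomputable def verletSeq (g : E → E) (h : ℝ) (x v : E) : ℕ → E
  | 0 => x
  | 1 => x + h • v - (h ^ 2 / 2) • g x
  | n + 2 => (2 : ℝ) • verletSeq g h x v (n + 1) - verletSeq g h x v n
      - h ^ 2 • g (verletSeq g h x v (n + 1))

/-- The derivative of the Verlet positions with respect to the initial velocity. -/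
noncomputable def verletDeriv (g : E → E) (h : ℝ) (x v : E) (n : ℕ) : E →L[ℝ] E :=
  fderiv ℝ (fun v => verletSeq g h x v n) v

theorem contDiff_verletSeq {g : E → E} {k : WithTop ℕ∞} (hg : ContDiff ℝ k g) (h : ℝ) (x : E)
    (n : ℕ) : ContDiff ℝ k fun v => verletSeq g h x v n := by
  induction n using Nat.twoStepInduction with
  | zero => exact contDiff_const
  | one => exact (contDiff_const.add (contDiff_id.const_smul h)).sub contDiff_const
  | more n h0 h1 => exact ((h1.const_smul (2 : ℝ)).sub h0).sub ((hg.comp h1).const_smul (h ^ 2))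

variable {g : E → E} {L L_H L_I T h : ℝ} {N : ℕ}

theorem SmoothForce.hasFDerivAt_verletSeq (hg : SmoothForce g L L_H L_I) (h : ℝ) (x v : E) (n : ℕ) :
    HasFDerivAt (fun v => verletSeq g h x v n) (verletDeriv g h x v n) v :=
  (((contDiff_verletSeq hg.contDiff h x n).differentiable (by norm_num)) v).hasFDerivAt

theorem verletDeriv_zero (x v : E) : verletDeriv g h x v 0 = 0 := by
  simp [verletDeriv, verletSeq]

theorem verletDeriv_one (x v : E) :
    verletDeriv g h x v 1 = h • ContinuousLinearMap.id ℝ E := by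
  have : HasFDerivAt (fun v => verletSeq g h x v 1) (h • ContinuousLinearMap.id ℝ E) v :=
    (((hasFDerivAt_id (𝕜 := ℝ) v).const_smul h).const_add x).sub_const ((h ^ 2 / 2) • g x)
  exact this.fderiv

theorem SmoothForce.verletDeriv_add_two (hg : SmoothForce g L L_H L_I) (x v : E) (n : ℕ) :
    verletDeriv g h x v (n + 2) = (2 : ℝ) • verletDeriv g h x v (n + 1) - verletDeriv g h x v n
      - h ^ 2 • (fderiv ℝ g (verletSeq g h x v (n + 1))).comp (verletDeriv g h x v (n + 1)) := by
  have h0 := hg.hasFDerivAt_verletSeq h x v n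
  have h1 := hg.hasFDerivAt_verletSeq h x v (n + 1)
  have : HasFDerivAt (fun v => verletSeq g h x v (n + 2)) _ v :=
    ((h1.const_smul (2 : ℝ)).sub h0).sub
      (((hg.differentiable _).hasFDerivAt.comp v h1).const_smul (h ^ 2))
  exact this.fderiv

theorem verletSeq_bounds (hg : SmoothForce g L L_H L_I) (hc : StepCondition T h L N) (x v : E) :
    (∀ n ≤ N, ‖verletSeq g h x v n‖ ≤ 12 / 11 * (‖x‖ + T * ‖v‖)) ∧
      ∀ n < N, ‖verletSeq g h x v (n + 1) - verletSeq g h x v n‖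
        ≤ h * (‖v‖ + T * (L * (12 / 11 * (‖x‖ + T * ‖v‖)))) := by
  have hh := hc.h_pos
  have := secondDiff_bounds hc (a := verletSeq g h x v) (b := v) (s := 0)
    (r := fun n => -(h ^ 2 • g (verletSeq g h x v n))) le_rfl
    (by simp only [verletSeq]; module) (fun n => by simp only [verletSeq]; module)
    (fun n _ => by
      rw [norm_neg, norm_smul, Real.norm_of_nonneg (by positivity), add_zero]
      gcongr
      exact hg.norm_le _) le_rfl le_rfl (M := 12 / 11 * (‖x‖ + T * ‖v‖))
    (by simp [verletSeq])
  exact ⟨this.1, fun n hn => by simpa using this.2.2.1 n hn⟩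

theorem verletDeriv_bounds (hg : SmoothForce g L L_H L_I) (hc : StepCondition T h L N) (x v : E) :
    (∀ n ≤ N, ‖verletDeriv g h x v n‖ ≤ 12 / 11 * T) ∧
      (∀ n < N, ‖verletDeriv g h x v (n + 1) - verletDeriv g h x v n‖ ≤ h * (13 / 11)) ∧
      ‖verletDeriv g h x v N - T • ContinuousLinearMap.id ℝ E‖ ≤ T / 11 := by
  have hh := hc.h_pos
  have hT := hc.T_pos
  have := secondDiff_bounds hc (a := verletDeriv g h x v) (b := ContinuousLinearMap.id ℝ E)
    (s := 0) (A := 0) (B := 1) (M := 12 / 11 * T)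
    (r := fun n => -(h ^ 2 • (fderiv ℝ g (verletSeq g h x v n)).comp (verletDeriv g h x v n)))
    le_rfl (by simp [verletDeriv_zero, verletDeriv_one])
    (fun n => by rw [hg.verletDeriv_add_two]; module)
    (fun n _ => by
      rw [norm_neg, norm_smul, Real.norm_of_nonneg (by positivity), add_zero]
      gcongr
      exact (ContinuousLinearMap.opNorm_comp_le _ _).trans
        (by gcongr; exact hg.norm_fderiv_le _))
    (by simp [verletDeriv_zero]) ContinuousLinearMap.norm_id_le (by simp)
  obtain ⟨h1, -, h3, h4⟩ := this
  have hLT : L * T ^ 2 ≤ 1 / 6 := hc.le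
  refine ⟨h1, fun n hn => (h3 n hn).trans ?_, ?_⟩
  · gcongr
    linarith
  · rw [verletDeriv_zero, sub_zero] at h4
    refine h4.trans ?_
    have : L * T ^ 2 * T ≤ 1 / 6 * T := by gcongr
    nlinarith

theorem verletSeq_sub_le (hg : SmoothForce g L L_H L_I) (hc : StepCondition T h L N) (x x' v v' : E) :
    ∀ n ≤ N, ‖verletSeq g h x v n - verletSeq g h x' v' n‖
      ≤ 12 / 11 * (‖x - x'‖ + T * ‖v - v'‖) := by
  have hh := hc.h_pos
  exact (secondDiff_bounds hc (a := fun n => verletSeq g h x v n - verletSeq g h x' v' n)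
    (b := v - v') (s := 0) (M := 12 / 11 * (‖x - x'‖ + T * ‖v - v'‖))
    (r := fun n => -(h ^ 2 • (g (verletSeq g h x v n) - g (verletSeq g h x' v' n)))) le_rfl
    (by simp only [verletSeq]; module) (fun n => by simp only [verletSeq]; module)
    (fun n _ => by
      rw [norm_neg, norm_smul, Real.norm_of_nonneg (by positivity), add_zero]
      gcongr
      exact hg.norm_sub_le _ _) le_rfl le_rfl (by simp [verletSeq])).1

theorem verletDeriv_sub_le (hg : SmoothForce g L L_H L_I) (hc : StepCondition T h L N)
    (x x' v v' : E) : ‖verletDeriv g h x v N - verletDeriv g h x' v' N‖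
      ≤ 13 / 20 * (L_H * T ^ 3 * (‖x - x'‖ + T * ‖v - v'‖)) := by
  have hh := hc.h_pos
  have hT := hc.T_pos
  have hLH := hg.L_H_nonneg
  set D := ‖x - x'‖ + T * ‖v - v'‖ with hD
  have hD0 : 0 ≤ D := by positivity
  have hq := verletSeq_sub_le hg hc x x' v v'
  have hQ := (verletDeriv_bounds hg hc x' v').1
  refine (secondDiff_bounds hc (a := fun n => verletDeriv g h x v n - verletDeriv g h x' v' n)
    (b := 0) (s := L_H * (12 / 11 * D) * (12 / 11 * T)) (A := 0) (B := 0)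
    (r := fun n => -(h ^ 2 • ((fderiv ℝ g (verletSeq g h x v n)).comp (verletDeriv g h x v n)
      - (fderiv ℝ g (verletSeq g h x' v' n)).comp (verletDeriv g h x' v' n)))) (by positivity)
    (by simp [verletDeriv_zero, verletDeriv_one])
    (fun n => by simp only [hg.verletDeriv_add_two]; module)
    (fun n hn => ?_) (by simp [verletDeriv_zero]) (by simp) ?_).1 N le_rfl
  · rw [norm_neg, norm_smul, Real.norm_of_nonneg (by positivity)]
    gcongr
    refine (hg.norm_fderiv_comp_sub_le _ _ _ _).trans ?_
    have h1 := hq n hn.le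
    have h2 := hQ n hn.le
    gcongr
  · have : 0 ≤ L_H * T ^ 3 * D := by positivity
    nlinarith

theorem norm_fderiv_verletDeriv_le (hg : SmoothForce g L L_H L_I) (hc : StepCondition T h L N)
    (x v : E) : ‖fderiv ℝ (fderiv ℝ fun v => verletSeq g h x v N) v‖ ≤ 13 / 20 * (L_H * T ^ 4) := by
  have hT := hc.T_pos
  have hLH := hg.L_H_nonneg
  refine norm_fderiv_le_of_lip' ℝ (by positivity) (Filter.Eventually.of_forall fun w => ?_)
  have := verletDeriv_sub_le hg hc x x w v
  rw [sub_self, norm_zero, zero_add] at this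
  refine this.trans (le_of_eq ?_)
  ring

theorem StepCondition.N_pos (hc : StepCondition T h L N) : 0 < N := by
  rcases Nat.eq_zero_or_pos N with h0 | h0
  · have h1 := hc.mul_eq
    have h2 := hc.T_pos
    rw [h0] at h1
    simp at h1
    linarith
  · exact h0

theorem StepCondition.half (hc : StepCondition T h L N) : StepCondition T (h / 2) L (2 * N) where
  T_pos := hc.T_pos
  h_pos := half_pos hc.h_pos
  L_nonneg := hc.L_nonneg
  mul_eq := by rw [← hc.mul_eq]; push_cast; ring
  le := hc.le

/-- The growth factor of the error of the Verlet positions. -/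
noncomputable def verletErr (L L_H T X w : ℝ) : ℝ :=
  12 / 11 * (T * (L * w / 8) + T ^ 2 / 32 * (L ^ 2 * X + 2 * L_H * w ^ 2))

theorem coarse_sub_fine_eq {q p f : ℕ → E} {k : E} {n : ℕ}
    (hq : q (n + 2) = (2 : ℝ) • q (n + 1) - q n - h ^ 2 • k)
    (h2 : p (2 * n + 2) = (2 : ℝ) • p (2 * n + 1) - p (2 * n) - (h / 2) ^ 2 • f (2 * n + 1))
    (h3 : p (2 * n + 3) = (2 : ℝ) • p (2 * n + 2) - p (2 * n + 1) - (h / 2) ^ 2 • f (2 * n + 2))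
    (h4 : p (2 * n + 4) = (2 : ℝ) • p (2 * n + 3) - p (2 * n + 2) - (h / 2) ^ 2 • f (2 * n + 3)) :
    q (n + 2) - p (2 * (n + 2)) = (2 : ℝ) • (q (n + 1) - p (2 * (n + 1))) - (q n - p (2 * n))
      + (-(h ^ 2 • (k - f (2 * n + 2)))
        + (h / 2) ^ 2 • (f (2 * n + 3) - (2 : ℝ) • f (2 * n + 2) + f (2 * n + 1))) := by
  rw [show 2 * (n + 2) = 2 * n + 4 by ring, show 2 * (n + 1) = 2 * n + 2 by ring]
  linear_combination (norm := module) hq - h4 - (2 : ℝ) • h3 - h2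

theorem norm_add_norm_sq_le_of_grid {p : ℕ → E} {δ V : ℝ} {n m : ℕ}
    (hp : ∀ j < n, ‖p (j + 1) - p j‖ ≤ δ * V) (hm : m + 1 < n) :
    ‖p (m + 2) - p (m + 1)‖ ^ 2 + ‖p m - p (m + 1)‖ ^ 2 ≤ 2 * (δ * V) ^ 2 := by
  have h1 := hp (m + 1) hm
  have h2 := hp m (by omega)
  rw [norm_sub_rev] at h2
  have h3 := pow_le_pow_left₀ (norm_nonneg _) h1 2
  have h4 := pow_le_pow_left₀ (norm_nonneg _) h2 2
  linarith

theorem verletSeq_sub_half_le (hg : SmoothForce g L L_H L_I) (hc : StepCondition T h L N) (x v : E)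
    {X V : ℝ} (hX : 12 / 11 * (‖x‖ + T * ‖v‖) ≤ X) (hV : ‖v‖ + T * (L * X) ≤ V) :
    ∀ n ≤ N, ‖verletSeq g h x v n - verletSeq g (h / 2) x v (2 * n)‖
      ≤ h ^ 2 * verletErr L L_H T X V := by
  have hh := hc.h_pos
  have hT := hc.T_pos
  have hLH := hg.L_H_nonneg
  have hL := hg.L_nonneg
  have hX0 : 0 ≤ X := le_trans (by positivity) hX
  have hV0 : 0 ≤ V := le_trans (by positivity) hV
  set δ := h / 2 with hδ
  have hδ0 : 0 < δ := half_pos hh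
  set p := verletSeq g δ x v with hp
  set q := verletSeq g h x v with hq
  obtain ⟨hp1, hp2⟩ := verletSeq_bounds hg hc.half x v
  have hpX : ∀ n ≤ 2 * N, ‖p n‖ ≤ X := fun n hn => (hp1 n hn).trans hX
  have hpV : ∀ n < 2 * N, ‖p (n + 1) - p n‖ ≤ δ * V := fun n hn =>
    (hp2 n hn).trans (by gcongr; exact le_trans (by gcongr) hV)
  have hp3 : ∀ n, p (n + 2) = (2 : ℝ) • p (n + 1) - p n - δ ^ 2 • g (p (n + 1)) := fun n => rfl
  have hN0 := hc.N_pos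
  set r : ℕ → E := fun n => match n with
    | 0 => 0
    | n + 1 => -(h ^ 2 • (g (q (n + 1)) - g (p (2 * n + 2))))
        + δ ^ 2 • (g (p (2 * n + 3)) - (2 : ℝ) • g (p (2 * n + 2)) + g (p (2 * n + 1))) with hr
  refine (secondDiff_bounds hc (a := fun n => q n - p (2 * n)) (r := r)
    (b := h⁻¹ • (q 1 - p 2)) (A := 0) (B := h ^ 2 * (L * V / 8))
    (s := h ^ 2 / 16 * (L ^ 2 * X + 2 * L_H * V ^ 2)) (by positivity) ?_ ?_ ?_ ?_ ?_ ?_).1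
  · simp [hr, hp, hq, verletSeq, smul_smul, mul_inv_cancel₀ hh.ne']
  · intro n
    exact coarse_sub_fine_eq (f := fun n => g (p n)) (k := g (q (n + 1))) rfl (hp3 _) (hp3 _) (hp3 _)
  · intro n hn
    cases n with
    | zero => simp only [hr, norm_zero]; positivity
    | succ n =>
      have h1 : ‖h ^ 2 • (g (q (n + 1)) - g (p (2 * n + 2)))‖
          ≤ h ^ 2 * (L * ‖q (n + 1) - p (2 * (n + 1))‖) := by
        rw [norm_smul, Real.norm_of_nonneg (by positivity)]
        gcongr
        exact hg.norm_sub_le _ _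
      have h2 := norm_secondDiff_comp_le (hg.contDiff.of_le (by norm_num)) hg.norm_fderiv_le
        hg.norm_fderiv_two_le (p (2 * n + 1)) (p (2 * n + 2)) (p (2 * n + 3))
      have h3 : ‖p (2 * n + 3) - (2 : ℝ) • p (2 * n + 2) + p (2 * n + 1)‖ ≤ δ ^ 2 * (L * X) := by
        rw [hp3 (2 * n + 1), show ∀ a b c : E, a - b - c - a + b = -c by intros; abel, norm_neg,
          norm_smul, Real.norm_of_nonneg (by positivity)]
        gcongr
        exact (hg.norm_le _).trans (by gcongr; exact hpX _ (by omega))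
      have h4 := norm_add_norm_sq_le_of_grid hpV (m := 2 * n + 1) (by omega)
      rw [hr]
      refine (norm_add_le _ _).trans ?_
      rw [norm_neg, norm_smul (δ ^ 2), Real.norm_of_nonneg (by positivity : 0 ≤ δ ^ 2)]
      have h5 : ‖g (p (2 * n + 3)) - (2 : ℝ) • g (p (2 * n + 2)) + g (p (2 * n + 1))‖
          ≤ L * (δ ^ 2 * (L * X)) + L_H * (2 * (δ * V) ^ 2) :=
        h2.trans (by gcongr)
      have h6 : δ ^ 2 * ‖g (p (2 * n + 3)) - (2 : ℝ) • g (p (2 * n + 2)) + g (p (2 * n + 1))‖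
          ≤ δ ^ 2 * (L * (δ ^ 2 * (L * X)) + L_H * (2 * (δ * V) ^ 2)) := by gcongr
      have h7 : δ ^ 2 * (L * (δ ^ 2 * (L * X)) + L_H * (2 * (δ * V) ^ 2))
          = h ^ 2 * (h ^ 2 / 16 * (L ^ 2 * X + 2 * L_H * V ^ 2)) := by rw [hδ]; ring
      rw [mul_add]
      linarith
  · simp [hp, hq, verletSeq]
  · have e : q 1 - p 2 = δ ^ 2 • (g (p 1) - g (p 0)) := by
      simp only [hp, hq, verletSeq, hδ]
      module
    have h1 := (hg.norm_sub_le (p 1) (p 0)).trans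
      (mul_le_mul_of_nonneg_left (hpV 0 (by omega)) hL)
    rw [e, norm_smul, norm_smul, norm_inv, Real.norm_of_nonneg hh.le,
      Real.norm_of_nonneg (by positivity)]
    calc _ ≤ h⁻¹ * (δ ^ 2 * (L * (δ * V))) := by gcongr
      _ = _ := by rw [hδ]; field_simp; ring
  · rw [verletErr]
    exact le_of_eq (by ring)

theorem norm_secondDiff_comp_clm_le (hg : SmoothForce g L L_H L_I) {q₁ q₂ q₃ : E}
    {P₁ P₂ P₃ : E →L[ℝ] E} {δ X V S R : ℝ} (hX : ‖q₃ - (2 : ℝ) • q₂ + q₁‖ ≤ δ ^ 2 * X)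
    (hV₁ : ‖q₃ - q₂‖ ≤ δ * V) (hV₂ : ‖q₁ - q₂‖ ≤ δ * V) (hS : ‖P₂‖ ≤ S)
    (hP : ‖P₃ - (2 : ℝ) • P₂ + P₁‖ ≤ δ ^ 2 * (L * S)) (hR₁ : ‖P₃ - P₂‖ ≤ δ * R)
    (hR₂ : ‖P₁ - P₂‖ ≤ δ * R) :
    ‖(fderiv ℝ g q₃).comp P₃ - (2 : ℝ) • (fderiv ℝ g q₂).comp P₂ + (fderiv ℝ g q₁).comp P₁‖
      ≤ δ ^ 2 * ((L_H * X + 2 * L_I * V ^ 2) * S + L ^ 2 * S + 2 * L_H * V * R) := by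
  have hLH := hg.L_H_nonneg
  have hLI := hg.L_I_nonneg
  have hL := hg.L_nonneg
  have hS0 := (norm_nonneg _).trans hS
  have hV0 := (norm_nonneg _).trans hV₁
  have e : (fderiv ℝ g q₃).comp P₃ - (2 : ℝ) • (fderiv ℝ g q₂).comp P₂ + (fderiv ℝ g q₁).comp P₁
      = (fderiv ℝ g q₃ - (2 : ℝ) • fderiv ℝ g q₂ + fderiv ℝ g q₁).comp P₂
        + (fderiv ℝ g q₂).comp (P₃ - (2 : ℝ) • P₂ + P₁)
        + ((fderiv ℝ g q₃ - fderiv ℝ g q₂).comp (P₃ - P₂)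
          + (fderiv ℝ g q₁ - fderiv ℝ g q₂).comp (P₁ - P₂)) := by
    ext w; simp; module
  have h1 : ‖fderiv ℝ g q₃ - (2 : ℝ) • fderiv ℝ g q₂ + fderiv ℝ g q₁‖
      ≤ L_H * (δ ^ 2 * X) + L_I * ((δ * V) ^ 2 + (δ * V) ^ 2) :=
    (norm_secondDiff_comp_le hg.contDiff_fderiv hg.norm_fderiv_two_le hg.norm_fderiv_three_le
      q₁ q₂ q₃).trans (by gcongr)
  have hcross : ∀ {a : E} {P : E →L[ℝ] E}, ‖a - q₂‖ ≤ δ * V → ‖P - P₂‖ ≤ δ * R →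
      ‖(fderiv ℝ g a - fderiv ℝ g q₂).comp (P - P₂)‖ ≤ L_H * (δ * V) * (δ * R) := by
    intro a P ha hP
    refine (ContinuousLinearMap.opNorm_comp_le _ _).trans ?_
    have := (hg.norm_fderiv_sub_le a q₂).trans (mul_le_mul_of_nonneg_left ha hLH)
    exact mul_le_mul this hP (norm_nonneg _) (by positivity)
  rw [e]
  calc _ ≤ (L_H * (δ ^ 2 * X) + L_I * ((δ * V) ^ 2 + (δ * V) ^ 2)) * S + L * (δ ^ 2 * (L * S))
        + (L_H * (δ * V) * (δ * R) + L_H * (δ * V) * (δ * R)) := by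
        refine (norm_add_le _ _).trans (add_le_add ((norm_add_le _ _).trans (add_le_add ?_ ?_))
          ((norm_add_le _ _).trans (add_le_add (hcross hV₁ hR₁) (hcross hV₂ hR₂))))
        · exact (ContinuousLinearMap.opNorm_comp_le _ _).trans
            (mul_le_mul h1 hS (norm_nonneg _) ((norm_nonneg _).trans h1))
        · exact (ContinuousLinearMap.opNorm_comp_le _ _).trans
            (mul_le_mul (hg.norm_fderiv_le _) hP (norm_nonneg _) hL)
    _ = _ := by ring

/-- The growth factor of the error of the velocity derivatives of the Verlet positions. -/
noncomputable def verletDerivErr (L L_H L_I T X w : ℝ) : ℝ :=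
  12 / 11 * (T * (L / 8) + T ^ 2 / 2 * (12 / 11 * T * L_H * verletErr L L_H T X w
    + 1 / 16 * ((L_H * (L * X) + 2 * L_I * w ^ 2) * (12 / 11 * T) + L ^ 2 * (12 / 11 * T)
      + 2 * L_H * w * (13 / 11))))

theorem verletDeriv_sub_half_le (hg : SmoothForce g L L_H L_I) (hc : StepCondition T h L N) (x v : E)
    {X V : ℝ} (hX : 12 / 11 * (‖x‖ + T * ‖v‖) ≤ X) (hV : ‖v‖ + T * (L * X) ≤ V) :
    ‖verletDeriv g h x v N - verletDeriv g (h / 2) x v (2 * N)‖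
      ≤ h ^ 2 * verletDerivErr L L_H L_I T X V := by
  have hh := hc.h_pos
  have hT := hc.T_pos
  have hLH := hg.L_H_nonneg
  have hLI := hg.L_I_nonneg
  have hL := hg.L_nonneg
  have hX0 : 0 ≤ X := le_trans (by positivity) hX
  have hV0 : 0 ≤ V := le_trans (by positivity) hV
  have he := verletSeq_sub_half_le hg hc x v hX hV
  set δ := h / 2 with hδ
  have hδ0 : 0 < δ := half_pos hh
  set p := verletSeq g δ x v with hp
  set q := verletSeq g h x v with hq
  set P := verletDeriv g δ x v with hP
  set Q := verletDeriv g h x v with hQ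
  obtain ⟨hp1, hp2⟩ := verletSeq_bounds hg hc.half x v
  obtain ⟨hP1, hP2, -⟩ := verletDeriv_bounds hg hc.half x v
  have hpX : ∀ n ≤ 2 * N, ‖p n‖ ≤ X := fun n hn => (hp1 n hn).trans hX
  have hpV : ∀ n < 2 * N, ‖p (n + 1) - p n‖ ≤ δ * V := fun n hn =>
    (hp2 n hn).trans (by gcongr; exact le_trans (by gcongr) hV)
  have hp3 : ∀ n, p (n + 2) = (2 : ℝ) • p (n + 1) - p n - δ ^ 2 • g (p (n + 1)) := fun n => rfl
  have hP3 : ∀ n, P (n + 2) = (2 : ℝ) • P (n + 1) - P n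
      - δ ^ 2 • (fderiv ℝ g (p (n + 1))).comp (P (n + 1)) := hg.verletDeriv_add_two x v
  have hN0 := hc.N_pos
  set r : ℕ → (E →L[ℝ] E) := fun n => match n with
    | 0 => 0
    | n + 1 => -(h ^ 2 • ((fderiv ℝ g (q (n + 1))).comp (Q (n + 1))
          - (fderiv ℝ g (p (2 * n + 2))).comp (P (2 * n + 2))))
        + δ ^ 2 • ((fderiv ℝ g (p (2 * n + 3))).comp (P (2 * n + 3))
          - (2 : ℝ) • (fderiv ℝ g (p (2 * n + 2))).comp (P (2 * n + 2))
          + (fderiv ℝ g (p (2 * n + 1))).comp (P (2 * n + 1))) with hr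
  set e := verletErr L L_H T X V with hedef
  have he0 : 0 ≤ e := by rw [hedef, verletErr]; positivity
  refine (secondDiff_bounds hc (a := fun n => Q n - P (2 * n)) (r := r)
    (b := h⁻¹ • (Q 1 - P 2)) (A := 0) (B := h ^ 2 * (L / 8))
    (s := h ^ 2 * (12 / 11 * T * L_H * e
      + 1 / 16 * ((L_H * (L * X) + 2 * L_I * V ^ 2) * (12 / 11 * T) + L ^ 2 * (12 / 11 * T)
      + 2 * L_H * V * (13 / 11)))) (by positivity) ?_ ?_ ?_ ?_ ?_ ?_).1 N le_rfl
  · simp [hr, hP, hQ, verletDeriv_zero, smul_smul, mul_inv_cancel₀ hh.ne']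
  · intro n
    exact coarse_sub_fine_eq (f := fun n => (fderiv ℝ g (p n)).comp (P n))
      (k := (fderiv ℝ g (q (n + 1))).comp (Q (n + 1))) (hg.verletDeriv_add_two x v n)
      (hP3 _) (hP3 _) (hP3 _)
  · intro n hn
    cases n with
    | zero => simp only [hr, norm_zero]; positivity
    | succ n =>
      have hPn := hP1 (2 * n + 2) (by omega)
      have h1 : ‖h ^ 2 • ((fderiv ℝ g (q (n + 1))).comp (Q (n + 1))
          - (fderiv ℝ g (p (2 * n + 2))).comp (P (2 * n + 2)))‖
          ≤ h ^ 2 * (L * ‖Q (n + 1) - P (2 * (n + 1))‖ + L_H * (h ^ 2 * e) * (12 / 11 * T)) := by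
        rw [norm_smul, Real.norm_of_nonneg (by positivity)]
        gcongr
        refine (hg.norm_fderiv_comp_sub_le _ _ _ _).trans ?_
        have h5 : ‖q (n + 1) - p (2 * n + 2)‖ ≤ h ^ 2 * e := he (n + 1) hn.le
        exact add_le_add le_rfl (mul_le_mul (mul_le_mul_of_nonneg_left h5 hLH) hPn
          (norm_nonneg _) (by positivity))
      have h2 : ‖p (2 * n + 3) - (2 : ℝ) • p (2 * n + 2) + p (2 * n + 1)‖ ≤ δ ^ 2 * (L * X) := by
        rw [hp3 (2 * n + 1), show ∀ a b c : E, a - b - c - a + b = -c by intros; abel, norm_neg,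
          norm_smul, Real.norm_of_nonneg (by positivity)]
        gcongr
        exact (hg.norm_le _).trans (by gcongr; exact hpX _ (by omega))
      have h3 : ‖P (2 * n + 3) - (2 : ℝ) • P (2 * n + 2) + P (2 * n + 1)‖
          ≤ δ ^ 2 * (L * (12 / 11 * T)) := by
        rw [hP3 (2 * n + 1), show ∀ a b c : E →L[ℝ] E, a - b - c - a + b = -c by intros; abel,
          norm_neg, norm_smul, Real.norm_of_nonneg (by positivity)]
        gcongr
        exact (ContinuousLinearMap.opNorm_comp_le _ _).trans
          (mul_le_mul (hg.norm_fderiv_le _) hPn (norm_nonneg _) hL)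
      have h4 := norm_secondDiff_comp_clm_le hg h2 (hpV (2 * n + 2) (by omega))
        (norm_sub_rev (p (2 * n + 2)) (p (2 * n + 1)) ▸ hpV (2 * n + 1) (by omega))
        hPn h3 (hP2 (2 * n + 2) (by omega))
        (norm_sub_rev (P (2 * n + 2)) (P (2 * n + 1)) ▸ hP2 (2 * n + 1) (by omega))
      rw [hr]
      refine (norm_add_le _ _).trans ?_
      rw [norm_neg, norm_smul (δ ^ 2), Real.norm_of_nonneg (by positivity : 0 ≤ δ ^ 2)]
      refine (add_le_add h1 (mul_le_mul_of_nonneg_left h4 (by positivity))).trans (le_of_eq ?_)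
      rw [hδ]; ring
  · simp [hP, hQ, verletDeriv_zero]
  · have e : Q 1 - P 2 = δ ^ 2 • (fderiv ℝ g (p 1)).comp (P 1) := by
      have := hP3 0
      rw [zero_add, zero_add] at this
      rw [this]
      simp only [hP, hQ, verletDeriv_zero, verletDeriv_one, hδ]
      module
    have h1 : ‖(fderiv ℝ g (p 1)).comp (P 1)‖ ≤ L * (δ * 1) := by
      refine (ContinuousLinearMap.opNorm_comp_le _ _).trans
        (mul_le_mul (hg.norm_fderiv_le _) ?_ (norm_nonneg _) hL)
      rw [hP, verletDeriv_one, norm_smul, Real.norm_of_nonneg hδ0.le]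
      gcongr
      exact ContinuousLinearMap.norm_id_le
    rw [e, norm_smul, norm_smul, norm_inv, Real.norm_of_nonneg hh.le,
      Real.norm_of_nonneg (by positivity)]
    calc _ ≤ h⁻¹ * (δ ^ 2 * (L * (δ * 1))) := by gcongr
      _ = _ := by rw [hδ]; field_simp; ring
  · rw [verletDerivErr]
    exact le_of_eq (by ring)

end VerletSequence

section StepHalvingEstimates

/-- Bound, in units of `h ^ 2`, for the vector field that transports one Verlet map to the next. -/
noncomputable def transportSize (L L_H T w y : ℝ) : ℝ :=
  L * (w / 5 + y / 20) + L_H * T * (w ^ 2 / 4 + y ^ 2 / 50)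

/-- Bound, in units of `h ^ 2`, for the derivative of the transport vector field. -/
noncomputable def transportDerivSize (L L_H L_I T w y : ℝ) : ℝ :=
  L / 2 + L_H * T * (w / 2 + y / 4) + (L_I * T ^ 2 + L_H ^ 2 * T ^ 4) * (w ^ 2 / 2 + y ^ 2 / 4)

theorem sq_velocity_le (w y : ℝ) :
    ((13 * w + 2 * y) / 11) ^ 2 ≤ (338 * w ^ 2 + 8 * y ^ 2) / 121 := by
  nlinarith [sq_nonneg (13 * w - 2 * y)]

theorem verletErr_le {L L_H T w y : ℝ} (hL : 0 ≤ L) (hLH : 0 ≤ L_H) (hT : 0 < T) (hw : 0 ≤ w)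
    (hy : 0 ≤ y) (hLT : L * T ^ 2 ≤ 1 / 6) :
    11 / 10 * verletErr L L_H T (12 / 11 * (T * (y + w))) ((13 * w + 2 * y) / 11)
      ≤ T * transportSize L L_H T w y := by
  unfold verletErr transportSize
  have h1 : L * T ^ 2 * (L * T * (y + w)) ≤ 1 / 6 * (L * T * (y + w)) := by gcongr
  have h2 := mul_le_mul_of_nonneg_left (sq_velocity_le w y) (by positivity : 0 ≤ T ^ 2 * L_H)
  have h3 : 0 ≤ T ^ 2 * L_H * w ^ 2 := by positivity
  have h4 : 0 ≤ T ^ 2 * L_H * y ^ 2 := by positivity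
  have h5 : 0 ≤ L * T * w := by positivity
  have h6 : 0 ≤ L * T * y := by positivity
  ring_nf at h1 h2 h3 h4 h5 h6 ⊢
  linarith

theorem verletDerivErr_le {L L_H L_I T w y : ℝ} (hL : 0 ≤ L) (hLH : 0 ≤ L_H) (hLI : 0 ≤ L_I)
    (hT : 0 < T) (hw : 0 ≤ w) (hy : 0 ≤ y) (hLT : L * T ^ 2 ≤ 1 / 6) :
    11 / 10 * (verletDerivErr L L_H L_I T (12 / 11 * (T * (y + w))) ((13 * w + 2 * y) / 11)
      + 13 / 20 * (L_H * T ^ 4) * transportSize L L_H T w y)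
      ≤ T * transportDerivSize L L_H L_I T w y := by
  have h0 := mul_le_mul_of_nonneg_left (verletErr_le hL hLH hT hw hy hLT)
    (by positivity : 0 ≤ T ^ 3 * L_H)
  unfold verletDerivErr
  set e := verletErr L L_H T (12 / 11 * (T * (y + w))) ((13 * w + 2 * y) / 11)
  unfold transportSize at h0 ⊢
  unfold transportDerivSize
  have h1 : L * T ^ 2 * (L_H * T ^ 2 * (w / 5 + y / 20)) ≤ 1 / 6 * (L_H * T ^ 2 * (w / 5 + y / 20)) := by
    gcongr
  have h2 : L * T ^ 2 * (L_H * T ^ 2 * (y + w)) ≤ 1 / 6 * (L_H * T ^ 2 * (y + w)) := by gcongr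
  have h3 : L * T ^ 2 * (L * T) ≤ 1 / 6 * (L * T) := by gcongr
  have h4 := mul_le_mul_of_nonneg_left (sq_velocity_le w y) (by positivity : 0 ≤ T ^ 3 * L_I)
  have k1 : 0 ≤ L * T := by positivity
  have k2 : 0 ≤ L_H * T ^ 2 * w := by positivity
  have k3 : 0 ≤ L_H * T ^ 2 * y := by positivity
  have k4 : 0 ≤ L_I * T ^ 3 * w ^ 2 := by positivity
  have k5 : 0 ≤ L_I * T ^ 3 * y ^ 2 := by positivity
  have k6 : 0 ≤ L_H ^ 2 * T ^ 5 * w ^ 2 := by positivity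
  have k7 : 0 ≤ L_H ^ 2 * T ^ 5 * y ^ 2 := by positivity
  ring_nf at h0 h1 h2 h3 h4 k1 k2 k3 k4 k5 k6 k7 ⊢
  linarith

theorem transportSize_sq_le {L L_H T w y : ℝ} (hL : 0 ≤ L) (hLH : 0 ≤ L_H) (hT : 0 < T)
    (hw : 0 ≤ w) (hy : 0 ≤ y) : transportSize L L_H T w y ^ 2
      ≤ L ^ 2 * (w ^ 2 + y ^ 2 / 4) + L_H ^ 2 * T ^ 2 * (w ^ 4 + y ^ 4 / 4) := by
  have h1 : transportSize L L_H T w y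
      ≤ L * (w / 2) + L * (y / 4) + L_H * T * (w ^ 2 / 2) + L_H * T * (y ^ 2 / 4) := by
    unfold transportSize
    have k1 : 0 ≤ L * w := by positivity
    have k2 : 0 ≤ L * y := by positivity
    have k3 : 0 ≤ L_H * T * w ^ 2 := by positivity
    have k4 : 0 ≤ L_H * T * y ^ 2 := by positivity
    linarith
  have h0 : 0 ≤ transportSize L L_H T w y := by unfold transportSize; positivity
  refine (pow_le_pow_left₀ h0 h1 2).trans ?_
  generalize ha : L * (w / 2) = a
  generalize hb : L * (y / 4) = b
  generalize hc : L_H * T * (w ^ 2 / 2) = c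
  generalize hd : L_H * T * (y ^ 2 / 4) = d
  have : (a + b + c + d) ^ 2 ≤ 4 * (a ^ 2 + b ^ 2 + c ^ 2 + d ^ 2) := by
    nlinarith [sq_nonneg (a - b), sq_nonneg (a - c), sq_nonneg (a - d), sq_nonneg (b - c),
      sq_nonneg (b - d), sq_nonneg (c - d)]
  refine this.trans (le_of_eq ?_)
  rw [← ha, ← hb, ← hc, ← hd]; ring

theorem transportDerivSize_sq_le {L L_H L_I T w y : ℝ} :
    transportDerivSize L L_H L_I T w y ^ 2
      ≤ 7 / 4 * (L ^ 2 + L_H ^ 2 * T ^ 2 * (w ^ 2 + y ^ 2 / 4)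
        + (L_I ^ 2 * T ^ 4 + L_H ^ 4 * T ^ 8) * (w ^ 4 + y ^ 4 / 4)) := by
  unfold transportDerivSize
  have key : ∀ f : Fin 7 → ℝ, (∑ i, f i) ^ 2 ≤ 7 * ∑ i, f i ^ 2 := fun f => by
    simpa using sq_sum_le_card_mul_sum_sq (s := Finset.univ) (f := f)
  have := key ![L / 2, L_H * T * (w / 2), L_H * T * (y / 4), L_I * T ^ 2 * (w ^ 2 / 2),
    L_I * T ^ 2 * (y ^ 2 / 4), L_H ^ 2 * T ^ 4 * (w ^ 2 / 2), L_H ^ 2 * T ^ 4 * (y ^ 2 / 4)]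
  simp [Fin.sum_univ_succ] at this
  refine (le_of_eq ?_).trans (this.trans (le_of_eq ?_)) <;> ring

/-- The square of the constant in the bias bound at the point `x` of norm `X`. -/
noncomputable def biasDensity (d L L_H L_I T X : ℝ) : ℝ :=
  (d ^ 3 * (4 * L_I ^ 2 * T ^ 4 + 14 * L_H ^ 2 * L_I * T ^ 6 + 14 * L_H ^ 4 * T ^ 8)
    + d ^ 2 * (35 * L_H ^ 2 * T ^ 2 + 8 * L_I ^ 2 * T ^ 4
        + 28 * L_H ^ 2 * L_I * T ^ 6 + 28 * L_H ^ 4 * T ^ 8)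
    + d * (16 * L ^ 2 + 4 * L_H ^ 2 * T ^ 2))
  + (2 * d * L_H ^ 2 + L ^ 2 / T ^ 2) * X ^ 2
  + (d * L_I ^ 2 + d * L_H ^ 2 * L_I * T ^ 2 + d * L_H ^ 4 * T ^ 4 + L_H ^ 2 / T ^ 2) * X ^ 4

theorem biasDensity_lower_bound {d L L_H L_I T y : ℝ} (hd : 0 ≤ d) (hLI : 0 ≤ L_I) (hT : 0 < T) :
    L ^ 2 * (d + y ^ 2 / 4) + L_H ^ 2 * T ^ 2 * ((d ^ 2 + 2 * d) + y ^ 4 / 4)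
      + d * (7 / 4 * (L ^ 2 + L_H ^ 2 * T ^ 2 * (d + y ^ 2 / 4)
        + (L_I ^ 2 * T ^ 4 + L_H ^ 4 * T ^ 8) * ((d ^ 2 + 2 * d) + y ^ 4 / 4)))
      ≤ 9 / 16 * biasDensity d L L_H L_I T (T * y) := by
  have e1 : L ^ 2 / T ^ 2 * (T * y) ^ 2 = L ^ 2 * y ^ 2 := by field_simp
  have e2 : L_H ^ 2 / T ^ 2 * (T * y) ^ 4 = L_H ^ 2 * T ^ 2 * y ^ 4 := by field_simp
  have k1 : 0 ≤ d ^ 3 * (L_I ^ 2 * T ^ 4) := by positivity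
  have k2 : 0 ≤ d ^ 3 * (L_H ^ 2 * L_I * T ^ 6) := by positivity
  have k3 : 0 ≤ d ^ 3 * (L_H ^ 4 * T ^ 8) := by positivity
  have k4 : 0 ≤ d ^ 2 * (L_H ^ 2 * T ^ 2) := by positivity
  have k5 : 0 ≤ d ^ 2 * (L_I ^ 2 * T ^ 4) := by positivity
  have k6 : 0 ≤ d ^ 2 * (L_H ^ 2 * L_I * T ^ 6) := by positivity
  have k7 : 0 ≤ d ^ 2 * (L_H ^ 4 * T ^ 8) := by positivity
  have k8 : 0 ≤ d * L ^ 2 := by positivity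
  have k9 : 0 ≤ d * (L_H ^ 2 * T ^ 2) := by positivity
  have k10 : 0 ≤ d * L_H ^ 2 * (T * y) ^ 2 := by positivity
  have k11 : 0 ≤ L ^ 2 * y ^ 2 := by positivity
  have k12 : 0 ≤ d * L_I ^ 2 * (T * y) ^ 4 := by positivity
  have k13 : 0 ≤ d * L_H ^ 2 * L_I * T ^ 2 * (T * y) ^ 4 := by positivity
  have k14 : 0 ≤ d * L_H ^ 4 * T ^ 4 * (T * y) ^ 4 := by positivity
  have k15 : 0 ≤ L_H ^ 2 * T ^ 2 * y ^ 4 := by positivity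
  unfold biasDensity
  rw [add_mul _ (L ^ 2 / T ^ 2), add_mul _ (L_H ^ 2 / T ^ 2), e1, e2]
  ring_nf at *
  linarith

variable {E : Type*} [NormedAddCommGroup E] [InnerProductSpace ℝ E] [FiniteDimensional ℝ E]
  [MeasurableSpace E] [BorelSpace E] {g : E → E} {L L_H L_I T h : ℝ} {N : ℕ}

theorem abs_measureReal_map_verletSeq_half_sub_le (hg : SmoothForce g L L_H L_I)
    (hc : StepCondition T h L N) (x : E) {A : Set E} (hA : MeasurableSet A) :
    |((stdGaussian E).map fun v => verletSeq g h x v N).real A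
        - ((stdGaussian E).map fun v => verletSeq g (h / 2) x v (2 * N)).real A|
      ≤ 3 / 4 * h ^ 2 * Real.sqrt (biasDensity (Module.finrank ℝ E) L L_H L_I T ‖x‖) := by
  have hh := hc.h_pos
  have hT := hc.T_pos
  have hLH := hg.L_H_nonneg
  have hLI := hg.L_I_nonneg
  have hL := hg.L_nonneg
  set D : ℝ := ((Module.finrank ℝ E : ℕ) : ℝ) with hD
  have hD0 : 0 ≤ D := Nat.cast_nonneg _
  set y := ‖x‖ / T with hy
  have hy0 : 0 ≤ y := by positivity
  have hxy : ‖x‖ = T * y := by rw [hy]; field_simp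
  have hX : ∀ v : E, 12 / 11 * (‖x‖ + T * ‖v‖) ≤ 12 / 11 * (T * (y + ‖v‖)) := fun v => by
    rw [hxy, mul_add T]
  have hV : ∀ v : E, ‖v‖ + T * (L * (12 / 11 * (T * (y + ‖v‖)))) ≤ (13 * ‖v‖ + 2 * y) / 11 :=
    fun v => by
      have : L * T ^ 2 * (y + ‖v‖) ≤ 1 / 6 * (y + ‖v‖) := by
        have := hc.le
        gcongr
      nlinarith
  have hm := abs_measureReal_map_stdGaussian_sub_le
    (contDiff_verletSeq hg.contDiff (h / 2) x (2 * N)) (contDiff_verletSeq hg.contDiff h x N) hT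
    (K := 13 / 20 * (L_H * T ^ 4))
    (fun v => (verletDeriv_bounds hg hc.half x v).2.2)
    (fun v => (verletDeriv_bounds hg hc x v).2.2)
    (fun v => norm_fderiv_verletDeriv_le hg hc.half x v)
    (fun v => norm_fderiv_verletDeriv_le hg hc x v)
    (α := fun v => h ^ 2 * transportSize L L_H T ‖v‖ y)
    (β := fun v => h ^ 2 * transportDerivSize L L_H L_I T ‖v‖ y)
    (fun v => by
      have h1 := verletSeq_sub_half_le hg hc x v (hX v) (hV v) N le_rfl
      have h2 := mul_le_mul_of_nonneg_left (verletErr_le hL hLH hT (norm_nonneg v) hy0 hc.le)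
        (sq_nonneg h)
      linarith)
    (fun v => by
      have h1 := verletDeriv_sub_half_le hg hc x v (hX v) (hV v)
      have h2 := mul_le_mul_of_nonneg_left
        (verletDerivErr_le hL hLH hLI hT (norm_nonneg v) hy0 hc.le) (sq_nonneg h)
      unfold verletDeriv at h1
      linarith)
  have hi0 : ∀ c : ℝ, Integrable (fun _ : E => c) (stdGaussian E) := fun c => integrable_const c
  have hi2 := integrable_norm_pow_stdGaussian (E := E) 2
  have hi4 := integrable_norm_pow_stdGaussian (E := E) 4
  have ha : ∀ v : E, (h ^ 2 * transportSize L L_H T ‖v‖ y) ^ 2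
      ≤ h ^ 4 * (L ^ 2 * (‖v‖ ^ 2 + y ^ 2 / 4) + L_H ^ 2 * T ^ 2 * (‖v‖ ^ 4 + y ^ 4 / 4)) :=
    fun v => by
      rw [mul_pow, ← pow_mul]
      gcongr
      exact transportSize_sq_le hL hLH hT (norm_nonneg v) hy0
  have hb : ∀ v : E, (h ^ 2 * transportDerivSize L L_H L_I T ‖v‖ y) ^ 2
      ≤ h ^ 4 * (7 / 4 * (L ^ 2 + L_H ^ 2 * T ^ 2 * (‖v‖ ^ 2 + y ^ 2 / 4)
        + (L_I ^ 2 * T ^ 4 + L_H ^ 4 * T ^ 8) * (‖v‖ ^ 4 + y ^ 4 / 4))) :=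
    fun v => by
      rw [mul_pow, ← pow_mul]
      gcongr
      exact transportDerivSize_sq_le
  have hai : Integrable (fun v : E => h ^ 4 * (L ^ 2 * (‖v‖ ^ 2 + y ^ 2 / 4)
      + L_H ^ 2 * T ^ 2 * (‖v‖ ^ 4 + y ^ 4 / 4))) (stdGaussian E) :=
    (((hi2.add (hi0 _)).const_mul _).add ((hi4.add (hi0 _)).const_mul _)).const_mul _
  have hbi : Integrable (fun v : E => h ^ 4 * (7 / 4 * (L ^ 2 + L_H ^ 2 * T ^ 2
      * (‖v‖ ^ 2 + y ^ 2 / 4) + (L_I ^ 2 * T ^ 4 + L_H ^ 4 * T ^ 8) * (‖v‖ ^ 4 + y ^ 4 / 4))))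
      (stdGaussian E) :=
    ((((hi0 _).add ((hi2.add (hi0 _)).const_mul _)).add
      ((hi4.add (hi0 _)).const_mul _)).const_mul _).const_mul _
  have hai' : Integrable (fun v : E => (h ^ 2 * transportSize L L_H T ‖v‖ y) ^ 2)
      (stdGaussian E) :=
    hai.mono' (by unfold transportSize; exact Continuous.aestronglyMeasurable (by fun_prop))
      (Filter.Eventually.of_forall fun v => by rw [Real.norm_of_nonneg (sq_nonneg _)]; exact ha v)
  have hbi' : Integrable (fun v : E => (h ^ 2 * transportDerivSize L L_H L_I T ‖v‖ y) ^ 2)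
      (stdGaussian E) :=
    hbi.mono' (by unfold transportDerivSize; exact Continuous.aestronglyMeasurable (by fun_prop))
      (Filter.Eventually.of_forall fun v => by rw [Real.norm_of_nonneg (sq_nonneg _)]; exact hb v)
  refine (hm hai' hbi' hA).trans ?_
  rw [show 3 / 4 * h ^ 2 * Real.sqrt (biasDensity D L L_H L_I T ‖x‖)
    = Real.sqrt ((3 / 4 * h ^ 2) ^ 2 * biasDensity D L L_H L_I T ‖x‖) by
      rw [Real.sqrt_mul (sq_nonneg _), Real.sqrt_sq (by positivity)]]
  refine Real.sqrt_le_sqrt ?_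
  calc _ ≤ ∫ v : E, (h ^ 4 * (L ^ 2 * y ^ 2 / 4 + L_H ^ 2 * T ^ 2 * y ^ 4 / 4
          + D * (7 / 4 * (L ^ 2 + L_H ^ 2 * T ^ 2 * (y ^ 2 / 4)
            + (L_I ^ 2 * T ^ 4 + L_H ^ 4 * T ^ 8) * (y ^ 4 / 4))))
        + h ^ 4 * (L ^ 2 + 7 / 4 * D * (L_H ^ 2 * T ^ 2)) * ‖v‖ ^ 2
        + h ^ 4 * (L_H ^ 2 * T ^ 2 + 7 / 4 * D * (L_I ^ 2 * T ^ 4 + L_H ^ 4 * T ^ 8)) * ‖v‖ ^ 4)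
          ∂(stdGaussian E) := by
        refine integral_mono (hai'.add (hbi'.const_mul D))
          (((hi0 _).add (hi2.const_mul _)).add (hi4.const_mul _)) fun v => ?_
        have h1 := ha v
        have h2 := mul_le_mul_of_nonneg_left (hb v) hD0
        simp only
        linarith
    _ = h ^ 4 * (L ^ 2 * (D + y ^ 2 / 4) + L_H ^ 2 * T ^ 2 * ((D ^ 2 + 2 * D) + y ^ 4 / 4)
      + D * (7 / 4 * (L ^ 2 + L_H ^ 2 * T ^ 2 * (D + y ^ 2 / 4)
        + (L_I ^ 2 * T ^ 4 + L_H ^ 4 * T ^ 8) * ((D ^ 2 + 2 * D) + y ^ 4 / 4)))) := by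
        rw [integral_add (by exact (hi0 _).add (hi2.const_mul _)) (hi4.const_mul _),
          integral_add (hi0 _) (hi2.const_mul _)]
        simp only [integral_const_mul, integral_const, probReal_univ, one_smul,
          integral_norm_sq_stdGaussian, integral_norm_pow_four_stdGaussian]
        rw [← hD]
        ring
    _ ≤ h ^ 4 * (9 / 16 * biasDensity D L L_H L_I T (T * y)) := by
        gcongr
        exact biasDensity_lower_bound hD0 hLI hT
    _ = _ := by rw [hxy]; ring

theorem abs_measureReal_map_verletSeq_sub_le (hg : SmoothForce g L L_H L_I)
    (hc : StepCondition T h L N) (x x' : E) {A : Set E} (hA : MeasurableSet A) :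
    |((stdGaussian E).map fun v => verletSeq g h x v N).real A
        - ((stdGaussian E).map fun v => verletSeq g h x' v N).real A|
      ≤ 3 / 2 * Real.sqrt (1 / T ^ 2 + 27 * Module.finrank ℝ E * L_H ^ 2 * T ^ 4) * ‖x - x'‖ := by
  have hT := hc.T_pos
  have hLH := hg.L_H_nonneg
  set D : ℝ := ((Module.finrank ℝ E : ℕ) : ℝ) with hD
  have hD0 : 0 ≤ D := Nat.cast_nonneg _
  set X := ‖x - x'‖
  have hX0 : 0 ≤ X := norm_nonneg _
  have hm := abs_measureReal_map_stdGaussian_sub_le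
    (contDiff_verletSeq hg.contDiff h x' N) (contDiff_verletSeq hg.contDiff h x N) hT
    (K := 13 / 20 * (L_H * T ^ 4))
    (fun v => (verletDeriv_bounds hg hc x' v).2.2)
    (fun v => (verletDeriv_bounds hg hc x v).2.2)
    (fun v => norm_fderiv_verletDeriv_le hg hc x' v)
    (fun v => norm_fderiv_verletDeriv_le hg hc x v)
    (α := fun _ => 6 / 5 * (X / T))
    (β := fun _ => 8 / 5 * (L_H * T ^ 2 * X))
    (fun v => by
      have h1 := verletSeq_sub_le hg hc x x' v v N le_rfl
      rw [sub_self, norm_zero, mul_zero, add_zero] at h1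
      have h2 : T * (6 / 5 * (X / T)) = 6 / 5 * X := by field_simp
      rw [h2]
      linarith)
    (fun v => by
      have h1 := verletDeriv_sub_le hg hc x x' v v
      rw [sub_self, norm_zero, mul_zero, add_zero] at h1
      have h2 : 13 / 20 * (L_H * T ^ 4) * (6 / 5 * (X / T)) = 39 / 50 * (L_H * T ^ 3 * X) := by
        field_simp; ring
      unfold verletDeriv at h1
      rw [h2]
      have h3 : 0 ≤ L_H * T ^ 3 * X := by positivity
      nlinarith)
    (integrable_const _) (integrable_const _) hA
  refine hm.trans ?_
  simp only [integral_const, probReal_univ, one_smul]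
  rw [show 3 / 2 * Real.sqrt (1 / T ^ 2 + 27 * D * L_H ^ 2 * T ^ 4) * X
    = Real.sqrt ((3 / 2 * X) ^ 2 * (1 / T ^ 2 + 27 * D * L_H ^ 2 * T ^ 4)) by
      rw [Real.sqrt_mul (sq_nonneg _), Real.sqrt_sq (by positivity)]; ring]
  refine Real.sqrt_le_sqrt ?_
  have h1 : 0 ≤ X ^ 2 / T ^ 2 := by positivity
  have h2 : 0 ≤ D * (L_H ^ 2 * T ^ 4 * X ^ 2) := by positivity
  have e1 : (6 / 5 * (X / T)) ^ 2 = 36 / 25 * (X ^ 2 / T ^ 2) := by rw [mul_pow, div_pow X T]; norm_num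
  have e2 : (3 / 2 * X) ^ 2 * (1 / T ^ 2 + 27 * D * L_H ^ 2 * T ^ 4)
      = 9 / 4 * (X ^ 2 / T ^ 2) + 243 / 4 * (D * (L_H ^ 2 * T ^ 4 * X ^ 2)) := by
    field_simp; ring
  rw [e1, e2]
  nlinarith

end StepHalvingEstimates

section TargetInvariance

variable {d : ℕ} {U : EuclideanSpace ℝ (Fin d) → ℝ} {L L_H L_I T h : ℝ} {N : ℕ}

theorem norm_iteratedFDeriv_gradient (U : EuclideanSpace ℝ (Fin d) → ℝ) (n : ℕ)
    (x : EuclideanSpace ℝ (Fin d)) :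
    ‖iteratedFDeriv ℝ n (gradient U) x‖ = ‖iteratedFDeriv ℝ (n + 1) U x‖ := by
  rw [← norm_iteratedFDeriv_fderiv]
  exact (InnerProductSpace.toDual ℝ (EuclideanSpace ℝ (Fin d))).symm.norm_iteratedFDeriv_comp_left
    (fderiv ℝ U) x n

theorem smoothForce_gradient (hU : ContDiff ℝ 4 U) (hmin : ∀ x, U 0 ≤ U x)
    (hL : ∀ x, ‖iteratedFDeriv ℝ 2 U x‖ ≤ L) (hL_H : ∀ x, ‖iteratedFDeriv ℝ 3 U x‖ ≤ L_H)
    (hL_I : ∀ x, ‖iteratedFDeriv ℝ 4 U x‖ ≤ L_I) : SmoothForce (gradient U) L L_H L_I where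
  contDiff :=
    (InnerProductSpace.toDual ℝ (EuclideanSpace ℝ (Fin d))).symm.contDiff.comp
      (hU.fderiv_right (m := 3) (by norm_num))
  map_zero := by
    have : IsLocalMin U 0 := Filter.Eventually.of_forall hmin
    simp [gradient, this.fderiv_eq_zero]
  norm_fderiv_le x := by
    rw [← norm_iteratedFDeriv_one, norm_iteratedFDeriv_gradient]
    exact hL x
  norm_fderiv_two_le x := by
    rw [← norm_iteratedFDeriv_one, norm_iteratedFDeriv_fderiv, norm_iteratedFDeriv_gradient]
    exact hL_H x
  norm_fderiv_three_le x := by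
    rw [← norm_iteratedFDeriv_one, norm_iteratedFDeriv_fderiv, norm_iteratedFDeriv_fderiv,
      norm_iteratedFDeriv_gradient]
    exact hL_I x

theorem verletStep_iterate_succ (U : EuclideanSpace ℝ (Fin d) → ℝ) (h : ℝ) (n : ℕ)
    (z : EuclideanSpace ℝ (Fin d) × EuclideanSpace ℝ (Fin d)) :
    (verletStep U h)^[n + 1] z = verletStep U h ((verletStep U h)^[n] z) :=
  Function.iterate_succ_apply' _ _ _

theorem verletPos_eq_verletSeq (U : EuclideanSpace ℝ (Fin d) → ℝ) (h : ℝ) (n : ℕ)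
    (x v : EuclideanSpace ℝ (Fin d)) :
    verletPos U h n x v = verletSeq (gradient U) h x v n := by
  induction n using Nat.twoStepInduction with
  | zero => rfl
  | one => rfl
  | more n h0 h1 =>
    have e : ∀ m, verletPos U h (m + 1) x v = verletPos U h m x v
        + h • ((verletStep U h)^[m] (x, v)).2 - (h ^ 2 / 2) • gradient U (verletPos U h m x v) :=
      fun m => by simp only [verletPos, verletStep_iterate_succ]; rfl
    have e' : ((verletStep U h)^[n + 1] (x, v)).2 = ((verletStep U h)^[n] (x, v)).2
        - (h / 2) • (gradient U (verletPos U h n x v) + gradient U (verletPos U h (n + 1) x v)) := by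
      simp only [verletPos, verletStep_iterate_succ]; rfl
    have e0 := e n
    have e1 := e (n + 1)
    rw [e'] at e1
    rw [verletSeq, ← h0, ← h1]
    linear_combination (norm := module) e1 - e0

/-- The Hamiltonian of a position-velocity pair. -/
noncomputable def hamiltonian (U : EuclideanSpace ℝ (Fin d) → ℝ)
    (z : EuclideanSpace ℝ (Fin d) × EuclideanSpace ℝ (Fin d)) : ℝ := U z.1 + ‖z.2‖ ^ 2 / 2

theorem norm_sq_verlet_velocity {F : Type*} [NormedAddCommGroup F] [InnerProductSpace ℝ F] {h : ℝ}
    {q q' v v' g g' : F} (hq : q' = q + h • v - (h ^ 2 / 2) • g)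
    (hv : v' = v - (h / 2) • (g + g')) :
    ‖v'‖ ^ 2 - ‖v‖ ^ 2
      = -inner ℝ (g + g') (q' - q) - h ^ 2 / 4 * (‖g‖ ^ 2 - ‖g'‖ ^ 2) := by
  have e : q' - q = h • v - (h ^ 2 / 2) • g := by rw [hq]; abel
  rw [hv, e, norm_sub_sq_real, norm_smul, mul_pow, norm_add_sq_real, Real.norm_eq_abs, sq_abs]
  simp only [inner_sub_right, inner_add_left, inner_add_right, inner_smul_right,
    real_inner_self_eq_norm_sq, real_inner_comm g v, real_inner_comm g' v, real_inner_comm g' g]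
  ring

theorem abs_hamiltonian_verlet_sub_le (hU : ContDiff ℝ 2 U)
    (hL : ∀ x, ‖iteratedFDeriv ℝ 2 U x‖ ≤ L) (hg : SmoothForce (gradient U) L L_H L_I)
    (hc : StepCondition T h L N) (x v : EuclideanSpace ℝ (Fin d)) {X V : ℝ}
    (hX : 12 / 11 * (‖x‖ + T * ‖v‖) ≤ X) (hV : ‖v‖ + T * (L * X) ≤ V) :
    |hamiltonian U ((verletStep U h)^[N] (x, v)) - hamiltonian U (x, v)|
      ≤ T * (3 / 2 * L * V ^ 2 + (L * X) ^ 2 / 8) * h := by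
  have hh := hc.h_pos
  have hL0 := hg.L_nonneg
  have hT := hc.T_pos
  have hX0 : 0 ≤ X := le_trans (by positivity) hX
  have hV0 : 0 ≤ V := le_trans (by positivity) hV
  set c := 3 / 2 * L * V ^ 2 + (L * X) ^ 2 / 8 with hcdef
  have hUdd : ∀ x, ‖fderiv ℝ (fderiv ℝ U) x‖ ≤ L := fun x => by
    rw [← norm_iteratedFDeriv_one, norm_iteratedFDeriv_fderiv]
    exact hL x
  obtain ⟨hq1, hq2⟩ := verletSeq_bounds hg hc x v
  have hstep : ∀ n < N, |hamiltonian U ((verletStep U h)^[n + 1] (x, v))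
      - hamiltonian U ((verletStep U h)^[n] (x, v))| ≤ h ^ 2 * c := by
    intro n hn
    set z := (verletStep U h)^[n] (x, v) with hz
    set z' := (verletStep U h)^[n + 1] (x, v) with hz'
    have hzz : z' = verletStep U h z := verletStep_iterate_succ U h n (x, v)
    have hzq : z.1 = verletSeq (gradient U) h x v n := verletPos_eq_verletSeq U h n x v
    have hzq' : z'.1 = verletSeq (gradient U) h x v (n + 1) := verletPos_eq_verletSeq U h (n + 1) x v
    have hpos : z'.1 = z.1 + h • z.2 - (h ^ 2 / 2) • gradient U z.1 := by rw [hzz]; rfl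
    have hvel : z'.2 = z.2 - (h / 2) • (gradient U z.1 + gradient U z'.1) := by rw [hzz]; rfl
    have hΔ : ‖z'.1 - z.1‖ ≤ h * V := by
      rw [hzq, hzq']
      exact (hq2 n hn).trans (by gcongr; exact le_trans (by gcongr) hV)
    have hΔ2 : ‖z'.1 - z.1‖ ^ 2 ≤ (h * V) ^ 2 := pow_le_pow_left₀ (norm_nonneg _) hΔ 2
    have hg1 : ‖gradient U z.1‖ ^ 2 ≤ (L * X) ^ 2 := by
      refine pow_le_pow_left₀ (norm_nonneg _) ((hg.norm_le _).trans ?_) 2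
      gcongr
      rw [hzq]; exact (hq1 n hn.le).trans hX
    have hg2 : ‖gradient U z'.1‖ ^ 2 ≤ (L * X) ^ 2 := by
      refine pow_le_pow_left₀ (norm_nonneg _) ((hg.norm_le _).trans ?_) 2
      gcongr
      rw [hzq']; exact (hq1 (n + 1) hn).trans hX
    have k1 := norm_sub_sub_fderiv_le hU hUdd z.1 z'.1
    have k2 : fderiv ℝ U z.1 (z'.1 - z.1) = inner ℝ (gradient U z.1) (z'.1 - z.1) := by
      simp [gradient]
    have k3 : |inner ℝ (gradient U z'.1 - gradient U z.1) (z'.1 - z.1)| ≤ L * ‖z'.1 - z.1‖ ^ 2 := by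
      refine (abs_real_inner_le_norm _ _).trans ?_
      rw [sq, ← mul_assoc]
      gcongr
      exact hg.norm_sub_le _ _
    have k4 := norm_sq_verlet_velocity hpos hvel
    have k5 : inner ℝ (gradient U z.1 + gradient U z'.1) (z'.1 - z.1)
        = 2 * inner ℝ (gradient U z.1) (z'.1 - z.1)
          + inner ℝ (gradient U z'.1 - gradient U z.1) (z'.1 - z.1) := by
      rw [inner_add_left, inner_sub_left]; ring
    rw [Real.norm_eq_abs, k2] at k1
    rw [k5] at k4
    have h2 : 0 < h ^ 2 := by positivity
    have k6 : h ^ 2 * ‖gradient U z.1‖ ^ 2 ≤ h ^ 2 * (L * X) ^ 2 := by gcongr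
    have k7 : h ^ 2 * ‖gradient U z'.1‖ ^ 2 ≤ h ^ 2 * (L * X) ^ 2 := by gcongr
    have k8 : 0 ≤ h ^ 2 * ‖gradient U z.1‖ ^ 2 := by positivity
    have k9 : 0 ≤ h ^ 2 * ‖gradient U z'.1‖ ^ 2 := by positivity
    have k10 : L * ‖z'.1 - z.1‖ ^ 2 ≤ L * (h * V) ^ 2 := by gcongr
    unfold hamiltonian
    rw [abs_le] at k1 k3 ⊢
    rw [hcdef]
    constructor <;> nlinarith [k1.1, k1.2, k3.1, k3.2]
  have hsum : ∀ n ≤ N, |hamiltonian U ((verletStep U h)^[n] (x, v)) - hamiltonian U (x, v)|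
      ≤ n * (h ^ 2 * c) := by
    intro n
    induction n with
    | zero => intro _; simp
    | succ n ih =>
      intro hn
      have h1 := ih (by omega)
      have h2 := hstep n (by omega)
      refine (abs_sub_le _ (hamiltonian U ((verletStep U h)^[n] (x, v))) _).trans ?_
      push_cast
      linarith
  refine (hsum N le_rfl).trans (le_of_eq ?_)
  rw [← hc.mul_eq]; ring

theorem measurePreserving_verletStep (U : EuclideanSpace ℝ (Fin d) → ℝ) (h : ℝ) :
    MeasurePreserving (verletStep U h) (volume.prod volume) (volume.prod volume) := by
  have hgm := measurable_gradient_aux U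
  have kick : MeasurePreserving (fun z : EuclideanSpace ℝ (Fin d) × EuclideanSpace ℝ (Fin d) =>
      (z.1, z.2 - (h / 2) • gradient U z.1)) (volume.prod volume) (volume.prod volume) :=
    (MeasurePreserving.id volume).skew_product (g := fun q v => v - (h / 2) • gradient U q)
      (by fun_prop) (Filter.Eventually.of_forall fun q =>
        (measurePreserving_sub_right volume ((h / 2) • gradient U q)).map_eq)
  have push : MeasurePreserving (fun z : EuclideanSpace ℝ (Fin d) × EuclideanSpace ℝ (Fin d) =>
      (z.1, z.2 + h • z.1)) (volume.prod volume) (volume.prod volume) :=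
    (MeasurePreserving.id volume).skew_product (g := fun v q => q + h • v)
      (by fun_prop) (Filter.Eventually.of_forall fun v =>
        (measurePreserving_add_right volume (h • v)).map_eq)
  have drift := (Measure.measurePreserving_swap (μ := volume (α := EuclideanSpace ℝ (Fin d)))
    (ν := volume (α := EuclideanSpace ℝ (Fin d)))).comp
      (push.comp Measure.measurePreserving_swap)
  have key := kick.comp (drift.comp kick)
  convert key using 1
  ext z : 1
  have e : z.1 + h • (z.2 - (h / 2) • gradient U z.1)
      = z.1 + h • z.2 - (h ^ 2 / 2) • gradient U z.1 := by module
  simp only [verletStep, Function.comp_apply, Prod.swap_prod_mk, e]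
  congr 1
  module

end TargetInvariance

section DensityUnderMeasurePreserving

variable {Ω : Type*} [MeasurableSpace Ω] {m : Measure Ω} {ρ : Ω → ℝ}

theorem measureReal_withDensity_ofReal (hρ : Integrable ρ m) (h0 : ∀ z, 0 ≤ ρ z) {B : Set Ω}
    (hB : MeasurableSet B) :
    (m.withDensity fun z => ENNReal.ofReal (ρ z)).real B = ∫ z in B, ρ z ∂m := by
  rw [measureReal_def, withDensity_apply _ hB,
    integral_eq_lintegral_of_nonneg_ae (Filter.Eventually.of_forall h0)
      hρ.aestronglyMeasurable.restrict]

theorem abs_measureReal_preimage_sub_le (hρ : Integrable ρ m) (h0 : ∀ z, 0 ≤ ρ z) {S : Ω → Ω}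
    (hS : MeasurePreserving S m m) {B : Set Ω} (hB : MeasurableSet B) :
    |(m.withDensity fun z => ENNReal.ofReal (ρ z)).real (S ⁻¹' B)
        - (m.withDensity fun z => ENNReal.ofReal (ρ z)).real B|
      ≤ 2 * ∫ z, max (ρ z - ρ (S z)) 0 ∂m := by
  have hρS : Integrable (fun z => ρ (S z)) m := hS.integrable_comp_of_integrable hρ
  have e : ∫ z in B, ρ z ∂m = ∫ z in S ⁻¹' B, ρ (S z) ∂m := by
    conv_lhs => rw [← hS.map_eq]
    exact setIntegral_map hB (hS.map_eq.symm ▸ hρ.aestronglyMeasurable) hS.measurable.aemeasurable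
  have e' : ∫ z, ρ z ∂m = ∫ z, ρ (S z) ∂m := by
    conv_lhs => rw [← hS.map_eq]
    exact integral_map hS.measurable.aemeasurable (hS.map_eq.symm ▸ hρ.aestronglyMeasurable)
  have hd : Integrable (fun z => ρ z - ρ (S z)) m := hρ.sub hρS
  rw [measureReal_withDensity_ofReal hρ h0 (hS.measurable hB),
    measureReal_withDensity_ofReal hρ h0 hB, e, ← integral_sub hρ.integrableOn hρS.integrableOn]
  calc _ ≤ ∫ z in S ⁻¹' B, |ρ z - ρ (S z)| ∂m := abs_integral_le_integral_abs
    _ ≤ ∫ z, |ρ z - ρ (S z)| ∂m :=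
        setIntegral_le_integral hd.abs (Filter.Eventually.of_forall fun z => abs_nonneg _)
    _ = ∫ z, (2 * max (ρ z - ρ (S z)) 0 - (ρ z - ρ (S z))) ∂m := by
        refine integral_congr_ae (Filter.Eventually.of_forall fun z => ?_)
        rcases le_total (ρ z - ρ (S z)) 0 with h | h
        · simp only [max_eq_right h, abs_of_nonpos h]; ring
        · simp only [max_eq_left h, abs_of_nonneg h]; ring
    _ = _ := by
        rw [integral_sub (hd.pos_part.const_mul 2) hd, integral_const_mul, integral_sub hρ hρS, e']
        ring

theorem tendsto_measureReal_preimage (hρ : Integrable ρ m) (h0 : ∀ z, 0 ≤ ρ z) {S : ℕ → Ω → Ω}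
    (hS : ∀ k, MeasurePreserving (S k) m m)
    (hlim : ∀ z, Filter.Tendsto (fun k => ρ (S k z)) Filter.atTop (nhds (ρ z))) {B : Set Ω}
    (hB : MeasurableSet B) :
    Filter.Tendsto (fun k => (m.withDensity fun z => ENNReal.ofReal (ρ z)).real (S k ⁻¹' B))
      Filter.atTop (nhds ((m.withDensity fun z => ENNReal.ofReal (ρ z)).real B)) := by
  have h1 : Filter.Tendsto (fun k => ∫ z, max (ρ z - ρ (S k z)) 0 ∂m) Filter.atTop
      (nhds (∫ _, 0 ∂m)) := by
    refine tendsto_integral_of_dominated_convergence ρ (fun k => ?_) hρ (fun k => ?_) ?_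
    · exact (hρ.sub ((hS k).integrable_comp_of_integrable hρ)).pos_part.aestronglyMeasurable
    · refine Filter.Eventually.of_forall fun z => ?_
      rw [Real.norm_of_nonneg (le_max_right _ _)]
      exact max_le (by linarith [h0 (S k z)]) (h0 z)
    · refine Filter.Eventually.of_forall fun z => ?_
      have := (tendsto_const_nhds (x := ρ z)).sub (hlim z)
      simpa using this.max (tendsto_const_nhds (x := (0 : ℝ)))
  rw [integral_zero] at h1
  rw [tendsto_iff_norm_sub_tendsto_zero]
  refine squeeze_zero (fun k => norm_nonneg _)
    (fun k => abs_measureReal_preimage_sub_le hρ h0 (hS k) hB) ?_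
  simpa using h1.const_mul 2

end DensityUnderMeasurePreserving

section Halving

variable {d : ℕ} {U : EuclideanSpace ℝ (Fin d) → ℝ} {L L_H L_I T h : ℝ} {N : ℕ}

theorem StepCondition.halves (hc : StepCondition T h L N) (k : ℕ) :
    StepCondition T (h / 2 ^ k) L (2 ^ k * N) := by
  induction k with
  | zero => simpa using hc
  | succ k ih =>
    have := ih.half
    rwa [div_div, ← pow_succ, ← mul_assoc, ← pow_succ'] at this

/-- The joint law of position and velocity in equilibrium has density proportional to
`exp(-H)`. -/
theorem targetMeasure_prod_stdGaussian (U : EuclideanSpace ℝ (Fin d) → ℝ)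
    (hU : Continuous U) :
    (targetMeasure U).prod (stdGaussian (EuclideanSpace ℝ (Fin d)))
      = (volume.prod volume).withDensity fun z => ENNReal.ofReal
          (gaussianConst (EuclideanSpace ℝ (Fin d)) / (∫ x, Real.exp (-U x))
            * Real.exp (-hamiltonian U z)) := by
  have hw := continuous_gaussianWeight (E := EuclideanSpace ℝ (Fin d))
  rw [targetMeasure, Measure.tilted, stdGaussian_eq_withDensity,
    prod_withDensity (by fun_prop) (by fun_prop)]
  congr 1
  ext z
  rw [← ENNReal.ofReal_mul (by positivity)]
  congr 1
  rw [hamiltonian, gaussianWeight, neg_add, Real.exp_add, neg_div]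
  ring

theorem tendsto_targetMeasure_verlet (hU : ContDiff ℝ 2 U)
    (hZ : Integrable (fun x => Real.exp (-U x)) volume)
    (hL : ∀ x, ‖iteratedFDeriv ℝ 2 U x‖ ≤ L) (hg : SmoothForce (gradient U) L L_H L_I)
    (hc : StepCondition T h L N) {B : Set (EuclideanSpace ℝ (Fin d) × EuclideanSpace ℝ (Fin d))}
    (hB : MeasurableSet B) :
    Filter.Tendsto (fun k : ℕ => ((targetMeasure U).prod
        (stdGaussian (EuclideanSpace ℝ (Fin d)))).real
          ((verletStep U (h / 2 ^ k))^[2 ^ k * N] ⁻¹' B)) Filter.atTop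
      (nhds (((targetMeasure U).prod (stdGaussian (EuclideanSpace ℝ (Fin d)))).real B)) := by
  have hUc := hU.continuous
  have hw : Integrable (fun z : EuclideanSpace ℝ (Fin d) × EuclideanSpace ℝ (Fin d) =>
      Real.exp (-hamiltonian U z)) (volume.prod volume) := by
    refine (hZ.mul_prod (integrable_gaussianWeight (E := EuclideanSpace ℝ (Fin d)))).congr
      (Filter.Eventually.of_forall fun z => ?_)
    simp only
    rw [hamiltonian, gaussianWeight, neg_add, Real.exp_add, neg_div]
  rw [targetMeasure_prod_stdGaussian U hUc]
  refine tendsto_measureReal_preimage (hw.const_mul _) (fun z => ?_)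
    (fun k => (measurePreserving_verletStep U (h / 2 ^ k)).iterate (2 ^ k * N)) (fun z => ?_) hB
  · have := gaussianConst_pos (E := EuclideanSpace ℝ (Fin d))
    positivity
  · have hlim : Filter.Tendsto
        (fun k : ℕ => hamiltonian U ((verletStep U (h / 2 ^ k))^[2 ^ k * N] z))
        Filter.atTop (nhds (hamiltonian U z)) := by
      rw [tendsto_iff_norm_sub_tendsto_zero]
      refine squeeze_zero (fun k => norm_nonneg _)
        (fun k => abs_hamiltonian_verlet_sub_le hU hL hg (hc.halves k) z.1 z.2 le_rfl le_rfl) ?_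
      have h1 : Filter.Tendsto (fun k : ℕ => h / 2 ^ k) Filter.atTop (nhds 0) := by
        simpa [div_eq_mul_inv] using
          (tendsto_pow_atTop_nhds_zero_of_lt_one (r := (1 / 2 : ℝ)) (by norm_num)
            (by norm_num)).const_mul h
      simpa using h1.const_mul _
    exact (((Real.continuous_exp.tendsto _).comp hlim.neg)).const_mul _

theorem uhmcKernel_apply (U : EuclideanSpace ℝ (Fin d) → ℝ) (h : ℝ) (N : ℕ)
    (x : EuclideanSpace ℝ (Fin d)) : uhmcKernel U h N x
      = (stdGaussian (EuclideanSpace ℝ (Fin d))).map fun v => verletSeq (gradient U) h x v N := by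
  simp only [← verletPos_eq_verletSeq]
  rfl

instance isMarkovKernel_uhmcKernel (U : EuclideanSpace ℝ (Fin d) → ℝ) (h : ℝ) (N : ℕ) :
    IsMarkovKernel (uhmcKernel U h N) where
  isProbabilityMeasure _ := Measure.isProbabilityMeasure_map
    ((measurable_verletPos U h N).comp measurable_prodMk_left).aemeasurable

theorem integral_uhmcKernel_eq (μ : Measure (EuclideanSpace ℝ (Fin d))) [IsProbabilityMeasure μ]
    (U : EuclideanSpace ℝ (Fin d) → ℝ) (h : ℝ) (N : ℕ) {A : Set (EuclideanSpace ℝ (Fin d))}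
    (hA : MeasurableSet A) :
    ∫ x, (uhmcKernel U h N x).real A ∂μ
      = (μ.prod (stdGaussian (EuclideanSpace ℝ (Fin d)))).real
          ((verletStep U h)^[N] ⁻¹' (A ×ˢ Set.univ)) := by
  have hm := (measurable_verletStep U h).iterate N
  rw [measureReal_def, Measure.prod_apply (hm (hA.prod MeasurableSet.univ))]
  simp only [measureReal_def]
  rw [integral_toReal ((uhmcKernel U h N).measurable_coe hA).aemeasurable
    (Filter.Eventually.of_forall fun x => measure_lt_top _ _)]
  congr 1
  refine lintegral_congr fun x => ?_
  have hx : Measurable (verletPos U h N x) :=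
    (measurable_verletPos U h N).comp measurable_prodMk_left
  have : uhmcKernel U h N x A
      = (stdGaussian (EuclideanSpace ℝ (Fin d))).map (verletPos U h N x) A := rfl
  rw [this, Measure.map_apply hx hA]
  congr 1
  ext v
  simp [verletPos]

theorem integrable_uhmcKernel_real (μ : Measure (EuclideanSpace ℝ (Fin d))) [IsProbabilityMeasure μ]
    (U : EuclideanSpace ℝ (Fin d) → ℝ) (h : ℝ) (N : ℕ) {A : Set (EuclideanSpace ℝ (Fin d))}
    (hA : MeasurableSet A) : Integrable (fun x => (uhmcKernel U h N x).real A) μ :=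
  Integrable.of_bound ((uhmcKernel U h N).measurable_coe hA).ennreal_toReal.aestronglyMeasurable 1
    (Filter.Eventually.of_forall fun x => by
      rw [Real.norm_of_nonneg measureReal_nonneg]; exact measureReal_le_one)

theorem abs_integral_uhmcKernel_sub_targetMeasure_le (hU : ContDiff ℝ 2 U)
    (hZ : Integrable (fun x => Real.exp (-U x)) volume)
    (hL : ∀ x, ‖iteratedFDeriv ℝ 2 U x‖ ≤ L) (hg : SmoothForce (gradient U) L L_H L_I)
    (hc : StepCondition T h L N) [IsProbabilityMeasure (targetMeasure U)]
    {A : Set (EuclideanSpace ℝ (Fin d))} (hA : MeasurableSet A)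
    (hi : Integrable (fun x => Real.sqrt (biasDensity d L L_H L_I T ‖x‖)) (targetMeasure U)) :
    |∫ x, (uhmcKernel U h N x).real A ∂(targetMeasure U) - (targetMeasure U).real A|
      ≤ h ^ 2 * ∫ x, Real.sqrt (biasDensity d L L_H L_I T ‖x‖) ∂(targetMeasure U) := by
  set μ := targetMeasure U with hμ
  set J := ∫ x, Real.sqrt (biasDensity d L L_H L_I T ‖x‖) ∂μ
  have hJ : 0 ≤ J := integral_nonneg fun x => Real.sqrt_nonneg _
  set a : ℕ → ℝ := fun k => ∫ x, (uhmcKernel U (h / 2 ^ k) (2 ^ k * N) x).real A ∂μ with ha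
  have hstep : ∀ k, |a k - a (k + 1)| ≤ 3 / 4 * h ^ 2 * (1 / 4) ^ k * J := by
    intro k
    rw [ha]
    simp only
    rw [← integral_sub (integrable_uhmcKernel_real μ U _ _ hA)
      (integrable_uhmcKernel_real μ U _ _ hA), ← integral_const_mul]
    refine abs_integral_le_integral_abs.trans (integral_mono_of_nonneg
      (Filter.Eventually.of_forall fun x => abs_nonneg _) (hi.const_mul _)
      (Filter.Eventually.of_forall fun x => ?_))
    have key := abs_measureReal_map_verletSeq_half_sub_le hg (hc.halves k) x hA
    rw [finrank_euclideanSpace_fin] at key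
    simp only [uhmcKernel_apply]
    rw [show h / 2 ^ (k + 1) = h / 2 ^ k / 2 by rw [pow_succ, div_div],
      show 2 ^ (k + 1) * N = 2 * (2 ^ k * N) by ring]
    refine key.trans (le_of_eq ?_)
    rw [div_pow, ← pow_mul, mul_comm k 2, pow_mul, div_pow, one_pow]
    norm_num
    left
    ring
  have hsum : ∀ k, |a 0 - a k| ≤ h ^ 2 * (1 - (1 / 4) ^ k) * J := by
    intro k
    induction k with
    | zero => simp
    | succ k ih =>
      refine (abs_sub_le _ (a k) _).trans ((add_le_add ih (hstep k)).trans (le_of_eq ?_))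
      rw [pow_succ]; ring
  have hlim : Filter.Tendsto a Filter.atTop (nhds (μ.real A)) := by
    have := tendsto_targetMeasure_verlet hU hZ hL hg hc (hA.prod MeasurableSet.univ)
    simp only [ha, integral_uhmcKernel_eq μ U _ _ hA]
    rwa [measureReal_def, Measure.prod_prod, measure_univ, mul_one] at this
  have h0 : a 0 = ∫ x, (uhmcKernel U h N x).real A ∂μ := by simp [ha]
  rw [← h0]
  refine le_of_tendsto (tendsto_const_nhds.sub hlim).abs (Filter.Eventually.of_forall fun k => ?_)
  refine (hsum k).trans ?_
  gcongr
  have : (0 : ℝ) ≤ (1 / 4) ^ k := by positivity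
  nlinarith [sq_nonneg h]

end Halving

section Assembly

variable {d : ℕ} {U : EuclideanSpace ℝ (Fin d) → ℝ} {L L_H L_I T h : ℝ} {N : ℕ}

theorem lintegral_sqrt_le_rpow {Ω : Type*} [MeasurableSpace Ω] {P : Measure Ω}
    [IsProbabilityMeasure P] {f : Ω → ℝ} (hf : Measurable f) :
    ∫⁻ x, ENNReal.ofReal (Real.sqrt (f x)) ∂P
      ≤ (∫⁻ x, ENNReal.ofReal (f x) ∂P) ^ (1 / 2 : ℝ) := by
  have h := ENNReal.lintegral_mul_le_Lp_mul_Lq P (p := 2) (q := 2)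
    (Real.HolderConjugate.two_two)
    (f := fun x => ENNReal.ofReal (Real.sqrt (f x))) (g := fun _ => 1)
    (by fun_prop) (by fun_prop)
  simp only [Pi.mul_apply, mul_one, ENNReal.one_rpow, lintegral_const, measure_univ] at h
  refine h.trans (le_of_eq ?_)
  congr 1
  refine lintegral_congr fun x => ?_
  rw [ENNReal.rpow_two, ← ENNReal.ofReal_pow (Real.sqrt_nonneg _)]
  rcases le_total 0 (f x) with hx | hx
  · rw [Real.sq_sqrt hx]
  · rw [Real.sqrt_eq_zero_of_nonpos hx, ENNReal.ofReal_of_nonpos hx]; simp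

theorem lintegral_sqrt_biasDensity_le (μ : Measure (EuclideanSpace ℝ (Fin d)))
    [IsProbabilityMeasure μ] (hLI : 0 ≤ L_I) :
    ∫⁻ x, ENNReal.ofReal (Real.sqrt (biasDensity d L L_H L_I T ‖x‖)) ∂μ
      ≤ biasConst d L L_H L_I T μ := by
  refine (lintegral_sqrt_le_rpow (by unfold biasDensity; fun_prop)).trans (le_of_eq ?_)
  unfold biasConst
  congr 1
  rw [← lintegral_const_mul _ (by fun_prop), ← lintegral_const_mul _ (by fun_prop)]
  have h1 : ∀ c : ℝ≥0∞, c = ∫⁻ _, c ∂μ := fun c => by simp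
  nth_rewrite 1 [h1 (ENNReal.ofReal (_ + _ + _))]
  rw [← lintegral_add_left (by fun_prop), ← lintegral_add_left (by fun_prop)]
  refine lintegral_congr fun x => ?_
  rw [← ofReal_norm, ← ENNReal.ofReal_pow (norm_nonneg _),
    ← ENNReal.ofReal_pow (norm_nonneg _), ← ENNReal.ofReal_mul (by positivity),
    ← ENNReal.ofReal_mul (by positivity), ← ENNReal.ofReal_add (by positivity) (by positivity),
    ← ENNReal.ofReal_add (by positivity) (by positivity)]
  rfl

theorem ofReal_abs_integral_uhmcKernel_sub_le (hg : SmoothForce (gradient U) L L_H L_I)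
    (hc : StepCondition T h L N) {μ μ' : Measure (EuclideanSpace ℝ (Fin d))}
    [IsProbabilityMeasure μ] [IsProbabilityMeasure μ'] {A : Set (EuclideanSpace ℝ (Fin d))}
    (hA : MeasurableSet A) :
    ENNReal.ofReal |∫ x, (uhmcKernel U h N x).real A ∂μ - ∫ x, (uhmcKernel U h N x).real A ∂μ'|
      ≤ ENNReal.ofReal (3 / 2 * Real.sqrt (1 / T ^ 2 + 27 * d * L_H ^ 2 * T ^ 4))
        * wasserstein1 μ μ' := by
  set c := 3 / 2 * Real.sqrt (1 / T ^ 2 + 27 * d * L_H ^ 2 * T ^ 4) with hcdef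
  have hc0 : 0 ≤ c := by positivity
  have hT := hc.T_pos
  have hcpos : 0 < c := by
    have : 0 < 1 / T ^ 2 + 27 * d * L_H ^ 2 * T ^ 4 := by positivity
    positivity
  unfold wasserstein1
  rw [ENNReal.mul_iInf_of_ne (by simpa using hcpos) ENNReal.ofReal_ne_top]
  refine le_iInf fun ω => ?_
  rw [ENNReal.mul_iInf_of_ne (by simpa using hcpos) ENNReal.ofReal_ne_top]
  refine le_iInf fun hω => ?_
  obtain ⟨h1, h2⟩ := hω
  have hωp : IsProbabilityMeasure ω := by
    refine ⟨?_⟩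
    rw [← Set.preimage_univ (f := Prod.fst), ← Measure.map_apply measurable_fst MeasurableSet.univ,
      h1, measure_univ]
  have hk : Measurable fun x => (uhmcKernel U h N x).real A :=
    ((uhmcKernel U h N).measurable_coe hA).ennreal_toReal
  have hb : ∀ x, ‖(uhmcKernel U h N x).real A‖ ≤ 1 := fun x => by
    rw [Real.norm_of_nonneg measureReal_nonneg]; exact measureReal_le_one
  have e1 : ∫ x, (uhmcKernel U h N x).real A ∂μ = ∫ p, (uhmcKernel U h N p.1).real A ∂ω := by
    rw [← h1, integral_map measurable_fst.aemeasurable hk.aestronglyMeasurable]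
  have e2 : ∫ x, (uhmcKernel U h N x).real A ∂μ' = ∫ p, (uhmcKernel U h N p.2).real A ∂ω := by
    rw [← h2, integral_map measurable_snd.aemeasurable hk.aestronglyMeasurable]
  have i1 : Integrable (fun p : EuclideanSpace ℝ (Fin d) × EuclideanSpace ℝ (Fin d) =>
      (uhmcKernel U h N p.1).real A) ω :=
    Integrable.of_bound (hk.comp measurable_fst).aestronglyMeasurable 1
      (Filter.Eventually.of_forall fun p => hb _)
  have i2 : Integrable (fun p : EuclideanSpace ℝ (Fin d) × EuclideanSpace ℝ (Fin d) =>
      (uhmcKernel U h N p.2).real A) ω :=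
    Integrable.of_bound (hk.comp measurable_snd).aestronglyMeasurable 1
      (Filter.Eventually.of_forall fun p => hb _)
  rw [e1, e2, ← integral_sub i1 i2, ← Real.norm_eq_abs, ofReal_norm,
    ← lintegral_const_mul' _ _ ENNReal.ofReal_ne_top]
  refine (enorm_integral_le_lintegral_enorm _).trans (lintegral_mono fun p => ?_)
  rw [edist_dist, ← ENNReal.ofReal_mul hc0, ← ofReal_norm, dist_eq_norm]
  refine ENNReal.ofReal_le_ofReal ?_
  have key := abs_measureReal_map_verletSeq_sub_le hg hc p.1 p.2 hA
  rw [finrank_euclideanSpace_fin] at key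
  rw [uhmcKernel_apply, uhmcKernel_apply]
  exact key

end Assembly

theorem theorem2 (d : ℕ) (U : EuclideanSpace ℝ (Fin d) → ℝ) (L L_H L_I : ℝ)
    -- `U` is four times continuously differentiable and `Z = ∫ exp(-U)` is finite
    (hU : ContDiff ℝ 4 U)
    (hZ : Integrable (fun x => Real.exp (-U x)) volume)
    -- (A1): global minimum at `0`, with value `0`
    (hU0 : U 0 = 0) (hmin : ∀ x, U 0 ≤ U x)
    -- (A2), (A3), (A4): `L`, `L_H`, `L_I` are the (finite) suprema of the operator norms of the
    -- derivatives of `U` of orders 2, 3 and 4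
    (hL : IsLUB (Set.range fun x => ‖iteratedFDeriv ℝ 2 U x‖) L)
    (hL_H : IsLUB (Set.range fun x => ‖iteratedFDeriv ℝ 3 U x‖) L_H)
    (hL_I : IsLUB (Set.range fun x => ‖iteratedFDeriv ℝ 4 U x‖) L_I)
    -- duration `T > 0` and step size `h > 0` with `T / h = N ∈ ℕ` and `L (T² + T h) ≤ 1/6`
    (T h : ℝ) (hT : 0 < T) (hh : 0 < h) (N : ℕ) (hN : T / h = N)
    (hLT : L * (T ^ 2 + T * h) ≤ 1 / 6)
    -- an invariant probability measure of the uHMC kernel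
    (μ' : Measure (EuclideanSpace ℝ (Fin d))) [IsProbabilityMeasure μ']
    (hinv : (uhmcKernel U h N).Invariant μ')
    -- (A6)
    (M₂ : ℝ) (hM₂ : 0 < M₂)
    (hW : wasserstein1 (targetMeasure U) μ' ≤ ENNReal.ofReal (M₂ * h ^ 2)) :
    tvDist (targetMeasure U) μ' ≤
      ENNReal.ofReal (h ^ 2) *
        (ENNReal.ofReal (3 / 2 * Real.sqrt (1 / T ^ 2 + 27 * d * L_H ^ 2 * T ^ 4) * M₂)
          + biasConst d L L_H L_I T (targetMeasure U)) := by
  have hLb : ∀ x, ‖iteratedFDeriv ℝ 2 U x‖ ≤ L := fun x => hL.1 ⟨x, rfl⟩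
  have hg : SmoothForce (gradient U) L L_H L_I := smoothForce_gradient hU hmin hLb
    (fun x => hL_H.1 ⟨x, rfl⟩) (fun x => hL_I.1 ⟨x, rfl⟩)
  have hL0 := hg.L_nonneg
  have hc : StepCondition T h L N :=
    { T_pos := hT
      h_pos := hh
      L_nonneg := hL0
      mul_eq := by rw [← hN]; field_simp
      le := by
        have : 0 ≤ L * (T * h) := by positivity
        linarith }
  have hμ : IsProbabilityMeasure (targetMeasure U) := isProbabilityMeasure_tilted hZ
  set μ := targetMeasure U with hμdef
  have hU2 : ContDiff ℝ 2 U := hU.of_le (by norm_num)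
  refine iSup₂_le fun A hA => ?_
  have hinvA : μ'.real A = ∫ x, (uhmcKernel U h N x).real A ∂μ' := by
    simp only [measureReal_def]
    rw [integral_toReal ((uhmcKernel U h N).measurable_coe hA).aemeasurable
      (Filter.Eventually.of_forall fun x => measure_lt_top _ _),
      ← Measure.bind_apply hA (uhmcKernel U h N).aemeasurable, hinv.def]
  have hJ : ENNReal.ofReal |∫ x, (uhmcKernel U h N x).real A ∂μ - μ.real A|
      ≤ ENNReal.ofReal (h ^ 2) * biasConst d L L_H L_I T μ := by
    refine le_trans ?_ (mul_le_mul_right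
      (lintegral_sqrt_biasDensity_le (L := L) (L_H := L_H) (T := T) μ hg.L_I_nonneg) _)
    by_cases hfin : ∫⁻ x, ENNReal.ofReal (Real.sqrt (biasDensity d L L_H L_I T ‖x‖)) ∂μ = ∞
    · rw [hfin, ENNReal.mul_top (by simpa using hh.ne')]
      exact le_top
    · have hm : Measurable fun x : EuclideanSpace ℝ (Fin d) =>
          Real.sqrt (biasDensity d L L_H L_I T ‖x‖) := by unfold biasDensity; fun_prop
      have hi : Integrable (fun x => Real.sqrt (biasDensity d L L_H L_I T ‖x‖)) μ :=
        (lintegral_ofReal_ne_top_iff_integrable hm.aestronglyMeasurable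
          (Filter.Eventually.of_forall fun x => Real.sqrt_nonneg _)).1 hfin
      rw [← ofReal_integral_eq_lintegral_ofReal hi
        (Filter.Eventually.of_forall fun x => Real.sqrt_nonneg _),
        ← ENNReal.ofReal_mul (sq_nonneg h)]
      exact ENNReal.ofReal_le_ofReal
        (abs_integral_uhmcKernel_sub_targetMeasure_le hU2 hZ hLb hg hc hA hi)
  have hWA := (ofReal_abs_integral_uhmcKernel_sub_le hg hc (μ := μ) (μ' := μ') hA).trans
    (mul_le_mul_right hW _)
  rw [← hinvA, ← ENNReal.ofReal_mul (by positivity)] at hWA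
  calc ENNReal.ofReal |μ.real A - μ'.real A|
      ≤ ENNReal.ofReal (|∫ x, (uhmcKernel U h N x).real A ∂μ - μ'.real A|
          + |∫ x, (uhmcKernel U h N x).real A ∂μ - μ.real A|) := by
        refine ENNReal.ofReal_le_ofReal ?_
        rw [add_comm, abs_sub_comm _ (μ.real A)]
        exact abs_sub_le _ _ _
    _ ≤ _ := by
        rw [ENNReal.ofReal_add (abs_nonneg _) (abs_nonneg _)]
        refine (add_le_add hWA hJ).trans (le_of_eq ?_)
        rw [mul_add, ← ENNReal.ofReal_mul (sq_nonneg h)]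
        congr 2
        ring
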